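/- Let $M$ be a compact connected oriented Seifert fibered 3-manifold with non-empty boundary, with Seifert invariants $(o,g,p,b\mid\alpha_1,\beta_1,\dots,\alpha_q,\beta_q)$ with $g\ge 0$ (orientable base) or $(n,g,p,b\mid\alpha_1,\beta_1,\dots,\alpha_q,\beta_q)$ with $g\ge 1$ (non-orientable base). Here $p\ge 1$ is the number of boundary components, $b\in\mathbb Z$, $q\ge 0$, and $0<\beta_j<\alpha_j$, $\gcd(\alpha_j,\beta_j)=1$ for $1\le j\le q$. Its fundamental group $G=\pi_1(M)$ is taken to be given by the canonical presentation attached to these invariants, namely $$\Big\langle a_1,b_1,\dots,a_g,b_g,\,c_1,\dots,c_q,\,d_1,\dots,d_p,\,h\ \Big|\ [a_i,h]=[b_i,h]=[c_j,h]=[d_k,h]=1,\ c_j^{\alpha_j}=h^{\beta_j},\ h^b=\Big(\prod_{i=1}^g[a_i,b_i]\Big)c_1\cdots c_q\,d_1\cdots d_p\Big\rangle$$ if the base is orientable, where $[x,y]=xyx^{-1}y^{-1}$, and $$\Big\langle a_1,\dots,a_g,\,c_1,\dots,c_q,\,d_1,\dots,d_p,\,h\ \Big|\ a_iha_i^{-1}=h^{-1},\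 [c_j,h]=[d_k,h]=1,\ c_j^{\alpha_j}=h^{\beta_j},\ h^b=\Big(\prod_{i=1}^g a_i^2\Big)c_1\cdots c_q\,d_1\cdots d_p\Big\rangle$$ if it is not. The boundary subgroups of $G$ are the conjugates $x\langle d_k,h\rangle x^{-1}$ with $x\in G$ and $1\le k\le p$; the subgroup $\langle d_k,h\rangle$ is the image of the fundamental group of the $k$-th boundary torus. Then the 2-cosets problem is solvable in $G$. That is, let $T,T'$ be any two boundary subgroups of $G$ (possibly $T=T'$). There is an algorithm which, given any two words in the canonical generators and their inverses, representing elements $u,v\in G$, determines the set $$C_{T,T'}(u,v)=\{(c,c')\in T\times T' \mid u=c\,v\,c'\}.$$ Explicitly, the algorithm either reports that this set is empty, or returns finitely many pairs of words, representing an element $(c_0,c_0')\in G\times G$ and elements $s_1,\dots,s_m\in G\times G$, such that $C_{T,T'}(u,v)=(c_0,c_0')\cdot\langle s_1,\dots,s_m\rangle$, where $\langle s_1,\dots,s_m\rangle$ is the subgroup of $G\times G$ generated by $s_1,\dots,s_m$. -/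

import Mathlib

/-- The topological type of the base surface of a Seifert fibration, boundary not counted:
orientable of genus `g ≥ 0`, or non-orientable of genus `g ≥ 1`. -/
inductive SeifertBase where
  | orientable (g : ℕ)
  | nonorientable (g : ℕ) (hg : 1 ≤ g)

/-- The generators coming from the base: `a₁, b₁, …, a_g, b_g` (orientable base; `Sum.inl i` is
`aᵢ`, `Sum.inr i` is `bᵢ`), or `a₁, …, a_g` (non-orientable base). -/
def SeifertBase.Gen : SeifertBase → Type
  | .orientable g => Fin g ⊕ Fin g
  | .nonorientable g _ => Fin g

instance (B : SeifertBase) : Primcodable B.Gen :=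
  match B with
  | .orientable g => inferInstanceAs (Primcodable (Fin g ⊕ Fin g))
  | .nonorientable g _ => inferInstanceAs (Primcodable (Fin g))

/-- The Seifert invariants `(o, g, p, b ∣ α₁, β₁, …, α_q, β_q)` or
`(n, g, p, b ∣ α₁, β₁, …, α_q, β_q)` of a Seifert fibration of a compact oriented 3-manifold:
`p` is the number of boundary components, `q` the number of exceptional fibres, and
`(αⱼ, βⱼ)` is the type of the `j`-th exceptional fibre. -/
structure SeifertInvariants where
  base : SeifertBase
  p : ℕ
  b : ℤ
  q : ℕ
  α : Fin q → ℕ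
  β : Fin q → ℕ
  β_pos : ∀ j, 0 < β j
  β_lt_α : ∀ j, β j < α j
  coprime : ∀ j, (α j).Coprime (β j)

namespace SeifertInvariants

/-- The canonical generators: those of the base, `c₁, …, c_q`, `d₁, …, d_p`, and `h`. -/
abbrev Gen (I : SeifertInvariants) : Type :=
  I.base.Gen ⊕ Fin I.q ⊕ Fin I.p ⊕ Unit

/-- The generator of the base named by `s`, in the free group on the canonical generators. -/
def fBase (I : SeifertInvariants) (s : I.base.Gen) : FreeGroup I.Gen :=
  .of (.inl s)

/-- `cⱼ` in the free group on the canonical generators. -/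
def fc (I : SeifertInvariants) (j : Fin I.q) : FreeGroup I.Gen :=
  .of (.inr (.inl j))

/-- `d_k` in the free group on the canonical generators. -/
def fd (I : SeifertInvariants) (k : Fin I.p) : FreeGroup I.Gen :=
  .of (.inr (.inr (.inl k)))

/-- `h` in the free group on the canonical generators. -/
def fh (I : SeifertInvariants) : FreeGroup I.Gen :=
  .of (.inr (.inr (.inr ())))

/-- The base part of the long relation, for a family `x` of elements of a group named by the
generators of the base: `[a₁, b₁] ⋯ [a_g, b_g]` or `a₁² ⋯ a_g²`. -/
def baseProd {F : Type} [Group F] : (B : SeifertBase) → (B.Gen → F) → F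
  | .orientable g, x =>
      (List.ofFn fun i : Fin g =>
        x (Sum.inl i) * x (Sum.inr i) * (x (Sum.inl i))⁻¹ * (x (Sum.inr i))⁻¹).prod
  | .nonorientable g _, x => (List.ofFn fun i : Fin g => x i ^ 2).prod

/-- The relator telling how the generator `s` of the base acts on `h`:
`s h s⁻¹ = h` over an orientable base, `s h s⁻¹ = h⁻¹` over a non-orientable one. -/
def baseRelator {F : Type} [Group F] : (B : SeifertBase) → (s h : F) → F
  | .orientable _, s, h => s * h * s⁻¹ * h⁻¹
  | .nonorientable _ _, s, h => s * h * s⁻¹ * h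

/-- The relators of the canonical presentation:
`[aᵢ, h] = [bᵢ, h] = 1` (orientable base) or `aᵢ h aᵢ⁻¹ = h⁻¹` (non-orientable base);
`[cⱼ, h] = [d_k, h] = 1`; `cⱼ ^ αⱼ = h ^ βⱼ`; and
`h ^ b = ([a₁, b₁] ⋯ [a_g, b_g]) c₁ ⋯ c_q d₁ ⋯ d_p`, respectively
`h ^ b = (a₁² ⋯ a_g²) c₁ ⋯ c_q d₁ ⋯ d_p`. -/
inductive Relator (I : SeifertInvariants) : FreeGroup I.Gen → Prop
  | base (s : I.base.Gen) : Relator I (baseRelator I.base (I.fBase s) I.fh)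
  | c_comm (j : Fin I.q) : Relator I (I.fc j * I.fh * (I.fc j)⁻¹ * I.fh⁻¹)
  | d_comm (k : Fin I.p) : Relator I (I.fd k * I.fh * (I.fd k)⁻¹ * I.fh⁻¹)
  | c_pow (j : Fin I.q) : Relator I (I.fc j ^ I.α j * (I.fh ^ I.β j)⁻¹)
  | long : Relator I
      (baseProd I.base I.fBase * (List.ofFn I.fc).prod * (List.ofFn I.fd).prod * (I.fh ^ I.b)⁻¹)

/-- The fundamental group of the Seifert fibered space with invariants `I`, given by its canonical
presentation. -/
abbrev Pi1 (I : SeifertInvariants) : Type :=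
  PresentedGroup {r : FreeGroup I.Gen | Relator I r}

/-- The canonical generators, as elements of the fundamental group. -/
def gen (I : SeifertInvariants) (i : I.Gen) : I.Pi1 :=
  PresentedGroup.of i

/-- The subgroup `⟨d_k, h⟩` of the fundamental group, carried by the `k`-th boundary torus. -/
def torusSubgroup (I : SeifertInvariants) (k : Fin I.p) : Subgroup I.Pi1 :=
  Subgroup.closure {I.gen (.inr (.inr (.inl k))), I.gen (.inr (.inr (.inr ())))}

/-- Boundary subgroups: the conjugates of the subgroups `⟨d_k, h⟩` (changing the path from the base
point to the boundary component conjugates the subgroup). -/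
def IsBoundarySubgroup (I : SeifertInvariants) (T : Subgroup I.Pi1) : Prop :=
  ∃ (k : Fin I.p) (x : I.Pi1), T = (I.torusSubgroup k).map (MulAut.conj x).toMonoidHom

end SeifertInvariants

namespace TwoCosets

/-- Words in the letters `ι` and their formal inverses: `(i, true)` stands for the letter `i`, and
`(i, false)` for its inverse. -/
abbrev Word (ι : Type) : Type := List (ι × Bool)

/-- The element of `G` represented by a word, where the letter `i` represents `x i`. -/
def Word.eval {ι G : Type} [Group G] (x : ι → G) (w : Word ι) : G :=
  (w.map fun l => if l.2 then x l.1 else (x l.1)⁻¹).prod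

/-- The element of `G × G` represented by a couple of words. -/
def evalPair {ι G : Type} [Group G] (x : ι → G) (w : Word ι × Word ι) : G × G :=
  (w.1.eval x, w.2.eval x)

/-- A finite description of a subset of `G × G`, in terms of words: `none` describes the empty
set, and `some (w, L)` the coset, through the couple represented by `w`, of the subgroup of `G × G`
generated by the couples represented by the entries of the list `L`. -/
abbrev Description (ι : Type) : Type :=
  Option ((Word ι × Word ι) × List (Word ι × Word ι))

/-- The subset of `G × G` with a given description. -/
def Description.toSet {ι G : Type} [Group G] (x : ι → G) : Description ι → Set (G × G)
  | none => ∅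
  | some (w, L) =>
      {z | ∃ s ∈ Subgroup.closure {y : G × G | ∃ l ∈ L, y = evalPair x l}, z = evalPair x w * s}

/-- `C_{T,T'}(u, v)`: the couples `(c, c') ∈ T × T'` with `u = c v c'`. -/
def solutions {G : Type} [Group G] (T T' : Subgroup G) (u v : G) : Set (G × G) :=
  {z | z.1 ∈ T ∧ z.2 ∈ T' ∧ u = z.1 * v * z.2}

/-- The 2-cosets problem for the (abelian) subgroups `T`, `T'` of the group `G` with generators
`x i` is solvable: there is an algorithm which, given two words representing elements `u`, `v`,
determines the set of all couples `(c, c') ∈ T × T'` with `u = c v c'`. (When `T'` is abelian, this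
set is empty or a coset of a subgroup of `T × T'`; the algorithm has to find out whether it is
empty, and if not to produce one solution and generators of that subgroup.) -/
def Solvable {ι G : Type} [Primcodable ι] [Group G] (x : ι → G) (T T' : Subgroup G) : Prop :=
  ∃ f : Word ι × Word ι → Description ι, Computable f ∧
    ∀ u v : Word ι, solutions T T' (u.eval x) (v.eval x) = (f (u, v)).toSet x

end TwoCosets

/-! The fibre subgroup ⟨h⟩ is normal, and every boundary subgroup has the form ⟨d, h⟩ with d
commuting with h. So T = ⟨d, h⟩ and T' = ⟨d', h⟩ are abelian, and u = c v c' has a solution in T ×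
T' exactly when a^m v b^n = u has one in Q = G/⟨h⟩, where a, b are the images of d, d'. Since there
is a boundary component, the long relation eliminates the last d_k, and Q is a free product of
cyclic groups (`exists_quotient`).

Such a free product has a length satisfying the four point condition of a tree
(`isTreeLength_length`), with balls of at most exponential size (`ballBound_length`). In a tree the
powers of one element stay bounded or run along almost geodesically. Hence, if a^m v b^n = u, each
a^i v with 0 ≤ i ≤ m can be multiplied on the right by a power of b so as to land in a ball whose
radius depends only on a, b and the lengths of u and v (`fellow_travel`). If m exceeds the size of
that ball, two of these elements coincide; this gives a^r v b^s = v with 0 < r < m, and the exponent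
can be lowered. The outcome is explicit bounds on some solution and on the least period
(`exists_small_solution`), so finite searches decide both.

The pairs with v = z v z' form a subgroup because T' is abelian. It is generated by (h, v⁻¹h⁻¹v) and
one pair (d^r, s), where r is the least positive period, or 0 if there is none; the solution set is
empty or a coset of this subgroup (`solutions_eq_coset`). Finding the missing powers of h takes the
word problem in G: normal forms in Q detect membership in ⟨h⟩, and an action on ℤ in which h is a
nonzero translation detects which power of h is trivial (`exists_action`). -/

/-! ### Tree-like length functions on groups -/

/-- A length function for which the left-invariant distance `ℓ (x⁻¹ * y)` satisfies the four point
condition, as it does in a tree. -/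
structure IsTreeLength {H : Type*} [Group H] (ℓ : H → ℕ) : Prop where
  one : ℓ 1 = 0
  inv (x : H) : ℓ x⁻¹ = ℓ x
  four (x y z : H) : ℓ (x⁻¹ * z) + ℓ y ≤ ℓ (x⁻¹ * y) + ℓ z ∨
    ℓ (x⁻¹ * z) + ℓ y ≤ ℓ x + ℓ (y⁻¹ * z)

namespace IsTreeLength

variable {H : Type*} [Group H] {ℓ : H → ℕ}

theorem mul_le (hℓ : IsTreeLength ℓ) (x y : H) : ℓ (x * y) ≤ ℓ x + ℓ y := by
  have h := hℓ.four x⁻¹ 1 y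
  simp only [inv_inv, mul_one, inv_one, one_mul, hℓ.one, hℓ.inv] at h
  omega

theorem four_dist (hℓ : IsTreeLength ℓ) (w x y z : H) :
    ℓ (x⁻¹ * z) + ℓ (w⁻¹ * y) ≤ ℓ (x⁻¹ * y) + ℓ (w⁻¹ * z) ∨
      ℓ (x⁻¹ * z) + ℓ (w⁻¹ * y) ≤ ℓ (w⁻¹ * x) + ℓ (y⁻¹ * z) := by
  have h := hℓ.four (w⁻¹ * x) (w⁻¹ * y) (w⁻¹ * z)
  have e (p q : H) : (w⁻¹ * p)⁻¹ * (w⁻¹ * q) = p⁻¹ * q := by group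
  simpa only [e] using h

/-! ### Powers of a single element: bounded, or of linear growth -/

theorem zpow_natAbs (hℓ : IsTreeLength ℓ) (a : H) (z : ℤ) : ℓ (a ^ z) = ℓ (a ^ z.natAbs) := by
  rcases Int.natAbs_eq z with h | h
  · conv_lhs => rw [h, zpow_natCast]
  · conv_lhs => rw [h, zpow_neg, zpow_natCast, hℓ.inv]

theorem four_zpow (hℓ : IsTreeLength ℓ) (a : H) (w x y z : ℤ) :
    ℓ (a ^ (z - x).natAbs) + ℓ (a ^ (y - w).natAbs) ≤
        ℓ (a ^ (y - x).natAbs) + ℓ (a ^ (z - w).natAbs) ∨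
      ℓ (a ^ (z - x).natAbs) + ℓ (a ^ (y - w).natAbs) ≤
        ℓ (a ^ (x - w).natAbs) + ℓ (a ^ (z - y).natAbs) := by
  have h := hℓ.four_dist (a ^ w) (a ^ x) (a ^ y) (a ^ z)
  have e (p q : ℤ) : (a ^ p)⁻¹ * a ^ q = a ^ (q - p) := by
    rw [← zpow_neg, ← zpow_add, neg_add_eq_sub]
  simpa only [e, hℓ.zpow_natAbs] using h

/-- The elliptic case. The four points 1, a^n, a^(n+1), a^(n+2) bound the length of a^(n+2) by that
of a^n, or by that of a^(n+1) plus a non-positive correction. -/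
theorem length_pow_le_of_sq_le (hℓ : IsTreeLength ℓ) (a : H) (h : ℓ (a ^ 2) ≤ ℓ (a ^ 1)) (n : ℕ) :
    ℓ (a ^ n) ≤ ℓ (a ^ 1) := by
  induction n using Nat.strong_induction_on with
  | _ n ih =>
    match n with
    | 0 => simp [hℓ.one]
    | 1 => exact le_rfl
    | n + 2 =>
      have h1 := ih n (by omega)
      have h2 := ih (n + 1) (by omega)
      have h4 := hℓ.four_zpow a (n + 1) 0 n (n + 2)
      rw [show ((n : ℤ) + 2 - 0).natAbs = n + 2 by omega,
        show ((n : ℤ) - (n + 1)).natAbs = 1 by omega, show ((n : ℤ) - 0).natAbs = n by omega,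
        show ((n : ℤ) + 2 - (n + 1)).natAbs = 1 by omega,
        show ((0 : ℤ) - (n + 1)).natAbs = n + 1 by omega,
        show ((n : ℤ) + 2 - n).natAbs = 2 by omega] at h4
      omega

/-- The hyperbolic case: each further power adds at least the positive amount ℓ(a²) - ℓ(a). In the
four point condition for 1, a^(n+1), a^(n+2), a^(n+3), the unwanted alternative contradicts the
growth already established. -/
theorem add_length_sq_le (hℓ : IsTreeLength ℓ) (a : H) (h : ℓ (a ^ 1) < ℓ (a ^ 2)) (n : ℕ) :
    ℓ (a ^ (n + 1)) + ℓ (a ^ 2) ≤ ℓ (a ^ (n + 2)) + ℓ (a ^ 1) := by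
  induction n with
  | zero => simp [add_comm]
  | succ n ih =>
    have h4 := hℓ.four_zpow a (n + 2) (n + 1) 0 (n + 3)
    rw [show ((n : ℤ) + 3 - (n + 1)).natAbs = 2 by omega,
      show ((0 : ℤ) - (n + 2)).natAbs = n + 2 by omega,
      show ((0 : ℤ) - (n + 1)).natAbs = n + 1 by omega,
      show ((n : ℤ) + 3 - (n + 2)).natAbs = 1 by omega,
      show ((n : ℤ) + 1 - (n + 2)).natAbs = 1 by omega,
      show ((n : ℤ) + 3 - 0).natAbs = n + 3 by omega] at h4
    rw [show n + 1 + 1 = n + 2 by omega, show n + 1 + 2 = n + 3 by omega]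
    omega

/-- Powers of any element form a quasi-geodesic, or stay bounded. -/
theorem exists_length_pow_add_le (hℓ : IsTreeLength ℓ) (a : H) :
    ∃ c, ∀ i j : ℕ, ℓ (a ^ i) + ℓ (a ^ j) ≤ ℓ (a ^ (i + j)) + c := by
  refine ⟨2 * ℓ (a ^ 1), fun i j => ?_⟩
  rcases le_or_gt (ℓ (a ^ 2)) (ℓ (a ^ 1)) with h | h
  · have h1 := hℓ.length_pow_le_of_sq_le a h i
    have h2 := hℓ.length_pow_le_of_sq_le a h j
    omega
  · match i, j with
    | 0, j => simp [hℓ.one]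
    | i + 1, 0 => simp [hℓ.one]
    | i + 1, j + 1 =>
      -- The path from a^(-(j+1)) to a^(i+1) is seen from 1, with a as an auxiliary fourth point.
      -- The alternative ℓ(a^(j+2)) + ℓ(a^(i+1)) ≤ ℓ(a^(j+1)) + ℓ(a^i) is excluded because lengths
      -- of powers strictly increase.
      have h4 := hℓ.four_zpow a 0 (-(j + 1)) (i + 1) 1
      rw [show ((1 : ℤ) - -(j + 1)).natAbs = j + 2 by omega,
        show ((i : ℤ) + 1 - 0).natAbs = i + 1 by omega,
        show ((i : ℤ) + 1 - -(j + 1)).natAbs = i + 1 + (j + 1) by omega,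
        show ((1 : ℤ) - 0).natAbs = 1 by omega,
        show (-((j : ℤ) + 1) - 0).natAbs = j + 1 by omega,
        show ((1 : ℤ) - (i + 1)).natAbs = i by omega] at h4
      have hj := hℓ.add_length_sq_le a h j
      have hi : ℓ (a ^ i) < ℓ (a ^ (i + 1)) := by
        match i with
        | 0 =>
          have := hℓ.mul_le (a ^ 1) (a ^ 1)
          rw [← pow_add, one_add_one_eq_two] at this
          rw [pow_zero, hℓ.one, zero_add]
          omega
        | i + 1 =>
          have := hℓ.add_length_sq_le a h i
          rw [show i + 1 + 1 = i + 2 by omega]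
          omega
      omega

/-- Among the steps of a discrete path there is one whose Gromov product, seen from `q`, is at most
that of the ends of the path. -/
theorem exists_step (hℓ : IsTreeLength ℓ) (q : H) (y : ℕ → H) (n : ℕ) :
    ∃ j ≤ n, ℓ (q⁻¹ * y j) + ℓ (q⁻¹ * y (j + 1)) + ℓ ((y 0)⁻¹ * y (n + 1)) ≤
      ℓ (q⁻¹ * y 0) + ℓ (q⁻¹ * y (n + 1)) + ℓ ((y j)⁻¹ * y (j + 1)) := by
  induction n with
  | zero => exact ⟨0, le_rfl, by simp⟩
  | succ n ih =>
    obtain ⟨j, hj, h⟩ := ih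
    -- Gromov products at q are ultrametric: that of the ends of the path is at least that of `y 0`
    -- and `y (n + 1)`, where induction applies, or at least that of the last step.
    have h4 := hℓ.four_dist q (y 0) (y (n + 1)) (y (n + 1 + 1))
    by_cases hc : ℓ ((y 0)⁻¹ * y (n + 1 + 1)) + ℓ (q⁻¹ * y (n + 1)) ≤
        ℓ ((y 0)⁻¹ * y (n + 1)) + ℓ (q⁻¹ * y (n + 1 + 1))
    · exact ⟨j, by omega, by omega⟩
    · exact ⟨n + 1, le_rfl, by omega⟩

/-- In a tree the Gromov product at q is the distance from q to the geodesic between the two ends.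
The path of points v b^j has steps of length ℓ(b), so one of its points comes within ℓ(b) of
achieving that distance. -/
theorem exists_near (hℓ : IsTreeLength ℓ) (q v b : H) (n : ℕ) :
    ∃ j : ℕ, 2 * ℓ (q⁻¹ * (v * b ^ j)) + ℓ (v⁻¹ * (v * b ^ n)) ≤
      ℓ (q⁻¹ * v) + ℓ (q⁻¹ * (v * b ^ n)) + 2 * ℓ b := by
  match n with
  | 0 => exact ⟨0, by simp only [pow_zero, mul_one, inv_mul_cancel, hℓ.one]; omega⟩
  | n + 1 =>
    obtain ⟨j, -, h⟩ := hℓ.exists_step q (fun j => v * b ^ j) n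
    refine ⟨j, ?_⟩
    have e : (v * b ^ j)⁻¹ * (v * b ^ (j + 1)) = b := by rw [pow_succ]; group
    simp only [e, pow_zero, mul_one] at h
    have h2 := hℓ.mul_le (q⁻¹ * (v * b ^ (j + 1))) b⁻¹
    rw [hℓ.inv, show q⁻¹ * (v * b ^ (j + 1)) * b⁻¹ = q⁻¹ * (v * b ^ j) by rw [pow_succ]; group] at h2
    omega

/-- If `a ^ m * v * b ^ n = u`, then the powers of `a` between `1` and `a ^ m` fellow travel with
the powers of `b`. -/
theorem fellow_travel (hℓ : IsTreeLength ℓ) (a b : H) :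
    ∃ K, ∀ (u v : H) (m : ℕ) (n : ℤ), a ^ m * v * b ^ n = u → ∀ i ≤ m,
      ∃ j : ℤ, ℓ (a ^ i * v * b ^ j) ≤ K + ℓ u + ℓ v := by
  obtain ⟨c, hc⟩ := hℓ.exists_length_pow_add_le a
  have key (u v b : H) (m n : ℕ) (h : a ^ m * v * b ^ n = u) (i : ℕ) (hi : i ≤ m) :
      ∃ j : ℕ, ℓ (a ^ i * v * b ^ j) ≤ c + ℓ b + ℓ u + ℓ v := by
    obtain ⟨k, rfl⟩ := Nat.exists_eq_add_of_le hi
    -- The path from v to v b^n has its ends within ℓ(v) and ℓ(u) of 1 and a^(-m). The point a^(-i)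
    -- is almost on a geodesic between these, up to the defect c, so the Gromov product at a^(-i) is
    -- bounded independently of i and m.
    obtain ⟨j, hj⟩ := hℓ.exists_near (a ^ i)⁻¹ v b n
    refine ⟨j, ?_⟩
    rw [inv_inv, ← mul_assoc] at hj
    have hc := hc i k
    have h1 := hℓ.mul_le (a ^ i) v
    have h2 := hℓ.mul_le (a ^ k)⁻¹ u
    rw [hℓ.inv, ← h, show (a ^ k)⁻¹ * (a ^ (i + k) * v * b ^ n) = a ^ i * (v * b ^ n) by
      rw [add_comm, pow_add]; group, h] at h2
    have h3 := hℓ.mul_le (u * (v * b ^ n)⁻¹ * v) v⁻¹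
    have h4 := hℓ.mul_le u ((v * b ^ n)⁻¹ * v)
    have h5 := hℓ.inv ((v * b ^ n)⁻¹ * v)
    rw [show ((v * b ^ n)⁻¹ * v)⁻¹ = v⁻¹ * (v * b ^ n) by group] at h5
    rw [hℓ.inv, show u * (v * b ^ n)⁻¹ * v * v⁻¹ = a ^ (i + k) by rw [← h]; group,
      mul_assoc u] at h3
    omega
  refine ⟨c + ℓ b, fun u v m n h i hi => ?_⟩
  rcases Int.natAbs_eq n with hn | hn
  · rw [hn, zpow_natCast] at h
    obtain ⟨j, hj⟩ := key u v b m _ h i hi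
    exact ⟨j, by simpa using hj⟩
  · rw [hn, zpow_neg, zpow_natCast, ← inv_pow] at h
    obtain ⟨j, hj⟩ := key u v b⁻¹ m _ h i hi
    exact ⟨-j, by simpa [hℓ.inv] using hj⟩

/-- Balls grow at most exponentially, with base `E`. -/
def BallBound (ℓ : H → ℕ) (E : ℕ) : Prop :=
  ∀ C : ℕ, ∃ S : Finset H, S.card ≤ E ^ C ∧ ∀ g, ℓ g ≤ C → g ∈ S

/-- Pigeonhole: the m elements a^i v b^(j_i) given by `fellow_travel` lie in a ball with fewer than
m elements. Two of them coincide, and the quotient of the corresponding powers is a period. -/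
theorem exists_period_of_lt (hℓ : IsTreeLength ℓ) {E : ℕ} (hE : BallBound ℓ E) (a b : H) :
    ∃ K, ∀ (u v : H) (m : ℕ) (n : ℤ), a ^ m * v * b ^ n = u → E ^ (K + ℓ u + ℓ v) < m →
      ∃ r : ℕ, 0 < r ∧ r < m ∧ ∃ s : ℤ, a ^ r * v * b ^ s = v := by
  obtain ⟨K, hK⟩ := hℓ.fellow_travel a b
  refine ⟨K, fun u v m n h hm => ?_⟩
  obtain ⟨S, hS, hmem⟩ := hE (K + ℓ u + ℓ v)
  choose! j hj using hK u v m n h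
  obtain ⟨i, hi, i', hi', hne, heq⟩ := Finset.exists_ne_map_eq_of_card_lt_of_maps_to
    (s := Finset.range m) (t := S) (f := fun i => a ^ i * v * b ^ j i)
    (by simpa using lt_of_le_of_lt hS hm)
    (fun i hi => hmem _ (hj i (by have := Finset.mem_range.1 hi; omega)))
  wlog hlt : i < i' generalizing i i'
  · exact this i' hi' i hi hne.symm heq.symm (by omega)
  have hi2 := Finset.mem_range.1 hi'
  refine ⟨i' - i, by omega, by omega, j i' - j i, ?_⟩
  obtain ⟨k, rfl⟩ := Nat.exists_eq_add_of_lt hlt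
  rw [show i + k + 1 - i = k + 1 by omega, zpow_sub]
  rw [show i + k + 1 = i + (k + 1) by omega, pow_add] at heq
  calc a ^ (k + 1) * v * (b ^ j (i + k + 1) * (b ^ j i)⁻¹)
      = (a ^ i)⁻¹ * (a ^ i * a ^ (k + 1) * v * b ^ j (i + (k + 1))) * (b ^ j i)⁻¹ := by group
    _ = v := by rw [← heq]; group

/-- Descent on m. A period a^r v b^s = v turns the solution (m, n) into (m - r, n - s); when u = v,
the smaller positive period r itself replaces m. -/
theorem exists_small_nat (hℓ : IsTreeLength ℓ) {E : ℕ} (hE : BallBound ℓ E) (a b : H) :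
    ∃ K, (∀ (u v : H) (m : ℕ) (n : ℤ), a ^ m * v * b ^ n = u →
        ∃ m' : ℕ, m' ≤ E ^ (K + ℓ u + ℓ v) ∧ ∃ n' : ℤ, a ^ m' * v * b ^ n' = u) ∧
      ∀ (v : H) (m : ℕ) (n : ℤ), 0 < m → a ^ m * v * b ^ n = v →
        ∃ m' : ℕ, 0 < m' ∧ m' ≤ E ^ (K + ℓ v + ℓ v) ∧ ∃ n' : ℤ, a ^ m' * v * b ^ n' = v := by
  obtain ⟨K, hK⟩ := hℓ.exists_period_of_lt hE a b
  refine ⟨K, fun u v m => ?_, fun v m => ?_⟩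
  · induction m using Nat.strong_induction_on with
    | _ m ih =>
      intro n h
      rcases le_or_gt m (E ^ (K + ℓ u + ℓ v)) with hm | hm
      · exact ⟨m, hm, n, h⟩
      · obtain ⟨r, hr, hrm, s, hs⟩ := hK u v m n h hm
        refine ih (m - r) (by omega) (n - s) ?_
        obtain ⟨k, rfl⟩ := Nat.exists_eq_add_of_lt hrm
        rw [show r + k + 1 - r = k + 1 by omega, ← h]
        conv_lhs => rw [← hs]
        rw [show r + k + 1 = (k + 1) + r by omega, pow_add, zpow_sub]
        group
  · induction m using Nat.strong_induction_on with
    | _ m ih =>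
      intro n h0 h
      rcases le_or_gt m (E ^ (K + ℓ v + ℓ v)) with hm | hm
      · exact ⟨m, h0, hm, n, h⟩
      · obtain ⟨r, hr, hrm, s, hs⟩ := hK v v m n h hm
        exact ih r hrm s hr hs

theorem exists_small_zpow (hℓ : IsTreeLength ℓ) {E : ℕ} (hE0 : 1 ≤ E) (hE : BallBound ℓ E)
    (a b : H) :
    ∃ K, ∀ (u v : H) (m n : ℤ), a ^ m * v * b ^ n = u →
      ∃ m' : ℤ, m'.natAbs ≤ E ^ (K + ℓ u + ℓ v) ∧ ∃ n' : ℤ, a ^ m' * v * b ^ n' = u := by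
  obtain ⟨K, hK, -⟩ := hℓ.exists_small_nat hE a b
  obtain ⟨K', hK', -⟩ := hℓ.exists_small_nat hE a⁻¹ b
  refine ⟨K + K', fun u v m n h => ?_⟩
  rcases Int.natAbs_eq m with hm | hm
  · rw [hm, zpow_natCast] at h
    obtain ⟨m', h1, n', h2⟩ := hK u v _ n h
    exact ⟨m', by simpa using h1.trans (Nat.pow_le_pow_right hE0 (by omega)), n', by simpa using h2⟩
  · rw [hm, zpow_neg, zpow_natCast, ← inv_pow] at h
    obtain ⟨m', h1, n', h2⟩ := hK' u v _ n h
    exact ⟨-m', by simpa using h1.trans (Nat.pow_le_pow_right hE0 (by omega)), n', by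
      simpa using h2⟩

/-- The exponents of a solution of `a ^ m * v * b ^ n = u`, and of a positive period of the set of
all solutions, can be bounded in terms of the lengths of `u` and `v`. -/
theorem exists_small_solution (hℓ : IsTreeLength ℓ) {E : ℕ} (hE0 : 1 ≤ E) (hE : BallBound ℓ E)
    (a b : H) :
    ∃ K, ∀ t,
      (∀ (u v : H) (m n : ℤ), ℓ u + ℓ v ≤ t → a ^ m * v * b ^ n = u →
        ∃ m' n' : ℤ, m'.natAbs ≤ E ^ (K + t) ∧ n'.natAbs ≤ E ^ (K + t + E ^ (K + t) * K) ∧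
          a ^ m' * v * b ^ n' = u) ∧
      (∀ (v : H) (m : ℕ) (n : ℤ), ℓ v + ℓ v ≤ t → 0 < m → a ^ m * v * b ^ n = v →
        ∃ (m' : ℕ) (n' : ℤ), 0 < m' ∧ m' ≤ E ^ (K + t) ∧ a ^ m' * v * b ^ n' = v) ∧
      ∀ (u v : H) (m n : ℤ), ℓ u + ℓ v ≤ t → m.natAbs ≤ E ^ (K + t) → a ^ m * v * b ^ n = u →
        ∃ n' : ℤ, n'.natAbs ≤ E ^ (K + t + E ^ (K + t) * K) ∧ a ^ m * v * b ^ n' = u := by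
  obtain ⟨K₁, h₁⟩ := hℓ.exists_small_zpow hE0 hE a b
  obtain ⟨K₂, -, h₂⟩ := hℓ.exists_small_nat hE a b
  obtain ⟨K₃, h₃⟩ := hℓ.exists_small_zpow hE0 hE b 1
  have hpow (z : ℤ) : ℓ (a ^ z) ≤ z.natAbs * ℓ a := by
    rw [hℓ.zpow_natAbs]
    induction z.natAbs with
    | zero => simp [hℓ.one]
    | succ n ih => rw [pow_succ, add_one_mul]; exact (hℓ.mul_le _ _).trans (by omega)
  set K := K₁ + K₂ + K₃ + ℓ a with hKdef
  have hb (t : ℕ) (u v : H) (m n : ℤ) (ht : ℓ u + ℓ v ≤ t) (hm : m.natAbs ≤ E ^ (K + t))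
      (h : a ^ m * v * b ^ n = u) :
      ∃ n' : ℤ, n'.natAbs ≤ E ^ (K + t + E ^ (K + t) * K) ∧ a ^ m * v * b ^ n' = u := by
    -- Once m is fixed, n only has to satisfy b^n = v⁻¹ a^(-m) u, the same problem for the pair (b,
    -- 1). The length of the right side is at most t + E^(K+t) K, which explains the iterated
    -- exponential bound.
    obtain ⟨n', hn', s, hs⟩ := h₃ (v⁻¹ * ((a ^ m)⁻¹ * u)) 1 n 0 (by rw [← h]; group)
    refine ⟨n', hn'.trans (Nat.pow_le_pow_right hE0 ?_), ?_⟩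
    · have e1 := hℓ.mul_le v⁻¹ ((a ^ m)⁻¹ * u)
      have e2 := hℓ.mul_le (a ^ m)⁻¹ u
      have e3 := hpow m
      have e4 := Nat.mul_le_mul hm (show ℓ a ≤ K by omega)
      rw [hℓ.inv] at e1 e2
      rw [hℓ.one]
      omega
    · rw [one_zpow, mul_one, mul_one] at hs
      rw [hs]
      group
  refine ⟨K, fun t => ⟨?_, ?_, hb t⟩⟩
  · intro u v m n ht h
    obtain ⟨m', hm', n', h'⟩ := h₁ u v m n h
    have hm2 : m'.natAbs ≤ E ^ (K + t) := hm'.trans (Nat.pow_le_pow_right hE0 (by omega))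
    obtain ⟨n'', hn'', h''⟩ := hb t u v m' n' ht hm2 h'
    exact ⟨m', n'', hm2, hn'', h''⟩
  · intro v m n ht h0 h
    obtain ⟨m', h0', hm', n', h'⟩ := h₂ v m n h0 h
    exact ⟨m', n', h0', hm'.trans (Nat.pow_le_pow_right hE0 (by omega)), h'⟩

end IsTreeLength

/-! ### A tree length on free products -/

namespace FreeProductLength

open Monoid

variable {J : Type*} {M : J → Type*}

/-- The total weight of the syllables of a list. -/
def listLength (wt : ∀ i, M i → ℕ) (L : List (Σ i, M i)) : ℕ :=
  (L.map fun s => wt s.1 s.2).sum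

theorem listLength_append (wt : ∀ i, M i → ℕ) (L L' : List (Σ i, M i)) :
    listLength wt (L ++ L') = listLength wt L + listLength wt L' := by
  simp [listLength]

@[simp] theorem listLength_cons (wt : ∀ i, M i → ℕ) (s : Σ i, M i) (L : List (Σ i, M i)) :
    listLength wt (s :: L) = wt s.1 s.2 + listLength wt L := by
  simp [listLength]

@[simp] theorem listLength_nil (wt : ∀ i, M i → ℕ) :
    listLength wt ([] : List (Σ i, M i)) = 0 := rfl

variable [∀ i, Group (M i)]

/-- The element of the free product represented by a list of syllables. -/
def listProd (L : List (Σ i, M i)) : CoprodI M :=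
  (L.map fun s => CoprodI.of s.2).prod

/-- Reduced lists of syllables. -/
def Reduced (L : List (Σ i, M i)) : Prop :=
  (∀ s ∈ L, s.2 ≠ 1) ∧ L.IsChain fun s t => s.1 ≠ t.1

/-- The list of syllables that represents the inverse. -/
def invList (L : List (Σ i, M i)) : List (Σ i, M i) :=
  (L.map fun s => ⟨s.1, s.2⁻¹⟩).reverse

@[simp] theorem listProd_nil : listProd ([] : List (Σ i, M i)) = 1 := rfl

@[simp] theorem listProd_cons (s : Σ i, M i) (L : List (Σ i, M i)) :
    listProd (s :: L) = CoprodI.of s.2 * listProd L := rfl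

theorem listProd_append (L L' : List (Σ i, M i)) :
    listProd (L ++ L') = listProd L * listProd L' := by
  simp [listProd]

theorem invList_cons (s : Σ i, M i) (L : List (Σ i, M i)) :
    invList (s :: L) = invList L ++ [⟨s.1, s.2⁻¹⟩] := by
  simp [invList]

theorem listProd_invList (L : List (Σ i, M i)) : listProd (invList L) = (listProd L)⁻¹ := by
  induction L with
  | nil => simp [invList]
  | cons s L ih => rw [invList_cons, listProd_append, ih]; simp

theorem Reduced.tail {s : Σ i, M i} {L : List (Σ i, M i)} (h : Reduced (s :: L)) : Reduced L :=
  ⟨fun t ht => h.1 t (List.mem_cons_of_mem _ ht), h.2.tail⟩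

theorem Reduced.invList {L : List (Σ i, M i)} (h : Reduced L) : Reduced (invList L) := by
  constructor
  · intro s hs
    simp only [FreeProductLength.invList, List.mem_reverse, List.mem_map] at hs
    obtain ⟨t, ht, rfl⟩ := hs
    exact inv_ne_one.2 (h.1 t ht)
  · rw [FreeProductLength.invList, List.isChain_reverse, List.isChain_map]
    exact h.2.imp fun _ _ h => h.symm

theorem getLast?_invList (L : List (Σ i, M i)) :
    (invList L).getLast? = L.head?.map fun s => ⟨s.1, s.2⁻¹⟩ := by
  simp [invList, List.head?_map]

theorem Reduced.append {L L' : List (Σ i, M i)} (h : Reduced L) (h' : Reduced L')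
    (hne : ∀ s ∈ L.getLast?, ∀ t ∈ L'.head?, s.1 ≠ t.1) : Reduced (L ++ L') := by
  constructor
  · intro s hs
    rcases List.mem_append.1 hs with hs | hs
    exacts [h.1 s hs, h'.1 s hs]
  · exact List.isChain_append.2 ⟨h.2, h'.2, hne⟩

theorem listLength_invList {wt : ∀ i, M i → ℕ} (hwt : ∀ i, IsTreeLength (wt i))
    (L : List (Σ i, M i)) : listLength wt (invList L) = listLength wt L := by
  induction L with
  | nil => rfl
  | cons s L ih => rw [invList_cons, listLength_append, ih]; simp [(hwt _).inv, add_comm]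

variable [DecidableEq J] [∀ i, DecidableEq (M i)]

/-- Twice the length of the common initial part of two lists of syllables. -/
def overlap (wt : ∀ i, M i → ℕ) : List (Σ i, M i) → List (Σ i, M i) → ℤ
  | [], _ => 0
  | _ :: _, [] => 0
  | ⟨i, a⟩ :: s, ⟨j, b⟩ :: t =>
    if h : i = j then
      if h ▸ a = b then 2 * wt i a + overlap wt s t
      else wt i a + wt j b - wt j ((h ▸ a)⁻¹ * b)
    else 0

theorem overlap_nil_right (wt : ∀ i, M i → ℕ) (L : List (Σ i, M i)) : overlap wt L [] = 0 := by
  cases L <;> simp [overlap]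

theorem overlap_cons_ne (wt : ∀ i, M i → ℕ) {i j : J} (h : i ≠ j) (a : M i) (b : M j)
    (s t : List (Σ i, M i)) : overlap wt (⟨i, a⟩ :: s) (⟨j, b⟩ :: t) = 0 := by
  simp [overlap, h]

theorem overlap_cons_self (wt : ∀ i, M i → ℕ) {i : J} (a : M i) (s t : List (Σ i, M i)) :
    overlap wt (⟨i, a⟩ :: s) (⟨i, a⟩ :: t) = 2 * wt i a + overlap wt s t := by
  simp [overlap]

theorem overlap_cons_eq (wt : ∀ i, M i → ℕ) {i : J} {a b : M i} (h : a ≠ b)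
    (s t : List (Σ i, M i)) :
    overlap wt (⟨i, a⟩ :: s) (⟨i, b⟩ :: t) = wt i a + wt i b - wt i (a⁻¹ * b) := by
  simp [overlap, h]

theorem overlap_nonneg {wt : ∀ i, M i → ℕ} (hwt : ∀ i, IsTreeLength (wt i)) :
    ∀ L L' : List (Σ i, M i), 0 ≤ overlap wt L L'
  | [], _ => by simp [overlap]
  | _ :: _, [] => by simp [overlap]
  | ⟨i, a⟩ :: s, ⟨j, b⟩ :: t => by
    by_cases h : i = j
    · subst h
      by_cases hab : a = b
      · subst hab
        have := overlap_nonneg hwt s t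
        rw [overlap_cons_self]
        omega
      · have := (hwt i).mul_le a⁻¹ b
        rw [(hwt i).inv] at this
        rw [overlap_cons_eq wt hab]
        omega
    · rw [overlap_cons_ne wt h]

/-- The overlap is twice a Gromov product, and this is the ultrametric form of the four point
condition. Equal first syllables are stripped off; three pairwise different ones in the same factor
reduce to the four point condition of that factor. -/
theorem overlap_ultrametric {wt : ∀ i, M i → ℕ} (hwt : ∀ i, IsTreeLength (wt i)) :
    ∀ X Y Z : List (Σ i, M i),
      overlap wt X Y ≤ overlap wt X Z ∨ overlap wt Y Z ≤ overlap wt X Z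
  | [], Y, Z => by simp [overlap]
  | X, Y, [] => by simp [overlap_nil_right]
  | X, [], Z => by
    left
    rw [overlap_nil_right]
    exact overlap_nonneg hwt X Z
  | ⟨i, a⟩ :: s, ⟨j, b⟩ :: t, ⟨k, c⟩ :: r => by
    have h0 := overlap_nonneg hwt (⟨i, a⟩ :: s) (⟨k, c⟩ :: r)
    by_cases hij : i = j
    swap
    · left; rwa [overlap_cons_ne wt hij]
    by_cases hjk : j = k
    swap
    · right; rwa [overlap_cons_ne wt hjk]
    subst hij hjk
    by_cases hab : a = b
    · subst hab
      by_cases hac : a = c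
      · subst hac
        simp only [overlap_cons_self]
        have := overlap_ultrametric hwt s t r
        omega
      · right; simp only [overlap_cons_eq wt hac]; exact le_rfl
    · by_cases hbc : b = c
      · subst hbc; left; simp only [overlap_cons_eq wt hab]; exact le_rfl
      · by_cases hac : a = c
        · subst hac
          left
          rw [overlap_cons_eq wt hab, overlap_cons_self]
          have h1 := (hwt i).mul_le a (a⁻¹ * b)
          have h2 := overlap_nonneg hwt s r
          rw [mul_inv_cancel_left] at h1
          omega
        · rw [overlap_cons_eq wt hab, overlap_cons_eq wt hbc, overlap_cons_eq wt hac]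
          have := (hwt i).four a b c
          omega

/-- The length of an element of the free product: the total weight of its reduced word. -/
def length (wt : ∀ i, M i → ℕ) (g : CoprodI M) : ℕ :=
  listLength wt (CoprodI.Word.equiv g).toList

theorem length_listProd (wt : ∀ i, M i → ℕ) {L : List (Σ i, M i)} (h : Reduced L) :
    length wt (listProd L) = listLength wt L := by
  have : CoprodI.Word.equiv.symm ⟨L, h.1, h.2⟩ = listProd L := rfl
  rw [length, ← this, Equiv.apply_symm_apply]

theorem exists_reduced (g : CoprodI M) : ∃ L, Reduced L ∧ listProd L = g :=
  ⟨(CoprodI.Word.equiv g).toList, ⟨(CoprodI.Word.equiv g).ne_one, (CoprodI.Word.equiv g).chain_ne⟩,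
    CoprodI.Word.equiv.symm_apply_apply g⟩

theorem eq_nil_of_listProd_eq_one {L : List (Σ i, M i)} (h : Reduced L) (h1 : listProd L = 1) :
    L = [] := by
  have e : CoprodI.Word.equiv.symm ⟨L, h.1, h.2⟩ =
      CoprodI.Word.equiv.symm (CoprodI.Word.empty : CoprodI.Word M) := h1
  exact congrArg CoprodI.Word.toList (CoprodI.Word.equiv.symm.injective e)

/-- Equal leading syllables cancel; different leading syllables of the same factor merge into one
nontrivial syllable a⁻¹b; those of different factors do not interact. In the last two cases the
resulting word is already reduced. -/
theorem length_inv_mul {wt : ∀ i, M i → ℕ} (hwt : ∀ i, IsTreeLength (wt i)) :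
    ∀ {L L' : List (Σ i, M i)}, Reduced L → Reduced L' →
      (length wt ((listProd L)⁻¹ * listProd L') : ℤ) =
        listLength wt L + listLength wt L' - overlap wt L L'
  | [], L', _, h' => by simp [overlap, length_listProd wt h']
  | L, [], h, _ => by
    rw [listProd_nil, mul_one, ← listProd_invList, length_listProd wt h.invList,
      listLength_invList hwt, overlap_nil_right]
    simp
  | ⟨i, a⟩ :: s, ⟨j, b⟩ :: t, h, h' => by
    by_cases hij : i = j
    · subst hij
      by_cases hab : a = b
      · subst hab
        rw [overlap_cons_self, listProd_cons, listProd_cons, mul_inv_rev, mul_assoc,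
          inv_mul_cancel_left, length_inv_mul hwt h.tail h'.tail]
        simp only [listLength_cons]
        omega
      · have hred : Reduced (invList s ++ ⟨i, a⁻¹ * b⟩ :: t) := by
          refine h.tail.invList.append ⟨?_, ?_⟩ ?_
          · intro u hu
            rcases List.mem_cons.1 hu with rfl | hu
            · simpa [inv_mul_eq_one] using hab
            · exact h'.tail.1 u hu
          · have := h'.2
            cases t <;> simp_all [List.isChain_cons_cons]
          · intro u hu v hv
            rw [getLast?_invList] at hu
            have := h.2
            cases s <;> simp_all [List.isChain_cons_cons]
            subst hu hv
            exact fun h => this.1 h.symm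
        have e : (listProd (⟨i, a⟩ :: s))⁻¹ * listProd (⟨i, b⟩ :: t) =
            listProd (invList s ++ ⟨i, a⁻¹ * b⟩ :: t) := by
          simp [listProd_append, listProd_invList, mul_assoc]
        rw [e, length_listProd wt hred, overlap_cons_eq wt hab, listLength_append,
          listLength_invList hwt]
        simp only [listLength_cons]
        omega
    · have hred : Reduced (invList (⟨i, a⟩ :: s) ++ ⟨j, b⟩ :: t) := by
        refine h.invList.append h' ?_
        intro u hu v hv
        rw [getLast?_invList] at hu
        simp only [List.head?_cons, Option.map_some, Option.mem_def, Option.some.injEq] at hu hv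
        subst hu hv
        exact hij
      rw [← listProd_invList, ← listProd_append, length_listProd wt hred, listLength_append,
        listLength_invList hwt, overlap_cons_ne wt hij]
      simp

theorem isTreeLength_length {wt : ∀ i, M i → ℕ} (hwt : ∀ i, IsTreeLength (wt i)) :
    IsTreeLength (length wt : CoprodI M → ℕ) where
  one := length_listProd wt (L := []) ⟨by simp, by simp⟩
  inv x := by
    obtain ⟨L, hL, rfl⟩ := exists_reduced x
    rw [← listProd_invList, length_listProd wt hL.invList, length_listProd wt hL,
      listLength_invList hwt]
  four x y z := by
    obtain ⟨X, hX, rfl⟩ := exists_reduced x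
    obtain ⟨Y, hY, rfl⟩ := exists_reduced y
    obtain ⟨Z, hZ, rfl⟩ := exists_reduced z
    have h1 := length_inv_mul hwt hX hY
    have h2 := length_inv_mul hwt hX hZ
    have h3 := length_inv_mul hwt hY hZ
    have h4 := overlap_ultrametric hwt X Y Z
    rw [length_listProd wt hX, length_listProd wt hY, length_listProd wt hZ]
    omega

open scoped Pointwise in
/-- If every factor is exhausted by the powers of a finite set, then balls in the free product grow
at most exponentially. -/
theorem ballBound_length [Finite J] {wt : ∀ i, M i → ℕ}
    (h : ∀ i, ∃ S : Finset (M i), ∀ a, a ∈ S ^ wt i a) :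
    ∃ E, 1 ≤ E ∧ IsTreeLength.BallBound (length wt : CoprodI M → ℕ) E := by
  classical
  have := Fintype.ofFinite J
  choose S hS using h
  let T : Finset (CoprodI M) := insert 1 (Finset.univ.biUnion fun i => (S i).image CoprodI.of)
  have h1 : 1 ∈ T := Finset.mem_insert_self _ _
  have hof (i : J) (a : M i) : CoprodI.of a ∈ T ^ wt i a := by
    have : (S i ^ wt i a).image (CoprodI.of : M i →* CoprodI M) ⊆ T ^ wt i a := by
      rw [Finset.image_pow]
      refine Finset.pow_subset_pow_left ?_
      intro x hx
      exact Finset.mem_insert_of_mem (Finset.mem_biUnion.2 ⟨i, Finset.mem_univ _, hx⟩)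
    exact this (Finset.mem_image_of_mem _ (hS i a))
  have hL (L : List (Σ i, M i)) : listProd L ∈ T ^ listLength wt L := by
    induction L with
    | nil => simp
    | cons s L ih =>
      rw [listProd_cons, listLength_cons, pow_add]
      exact Finset.mul_mem_mul (hof _ _) ih
  refine ⟨T.card, Finset.card_pos.2 ⟨1, h1⟩, fun C => ⟨T ^ C, Finset.card_pow_le, ?_⟩⟩
  intro g hg
  obtain ⟨L, hred, rfl⟩ := exists_reduced g
  rw [length_listProd wt hred] at hg
  exact Finset.pow_subset_pow_right h1 hg (hL L)

end FreeProductLength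

/-! ### Cyclic factors -/

/-- The absolute value on an infinite cyclic group, the discrete length on a finite one. -/
def cyclicWeight : (n : ℕ) → Multiplicative (ZMod n) → ℕ
  | 0, a => Int.natAbs (Multiplicative.toAdd a : ℤ)
  | _ + 1, a => if a = 1 then 0 else 1

/-- The distances are those of points on a line, or of the leaves of a star with edges of length one
half. -/
theorem isTreeLength_cyclicWeight : ∀ n, IsTreeLength (cyclicWeight n)
  | 0 =>
    { one := rfl
      inv := fun x => Int.natAbs_neg _
      four := fun x y z => by
        have e (p q : Multiplicative (ZMod 0)) : cyclicWeight 0 (p⁻¹ * q) =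
          Int.natAbs (-(Multiplicative.toAdd p : ℤ) + (Multiplicative.toAdd q : ℤ)) := rfl
        have e' (p : Multiplicative (ZMod 0)) : cyclicWeight 0 p =
          Int.natAbs (Multiplicative.toAdd p : ℤ) := rfl
        rw [e, e, e, e', e', e']
        generalize (Multiplicative.toAdd x : ℤ) = x
        generalize (Multiplicative.toAdd y : ℤ) = y
        generalize (Multiplicative.toAdd z : ℤ) = z
        omega }
  | n + 1 =>
    { one := by simp [cyclicWeight]
      inv := fun x => by simp [cyclicWeight]
      four := fun x y z => by
        simp only [cyclicWeight, inv_mul_eq_one]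
        by_cases hx : x = 1 <;> by_cases hy : y = 1 <;> by_cases hz : z = 1 <;>
          by_cases hxy : x = y <;> by_cases hyz : y = z <;> by_cases hxz : x = z <;> simp_all }

open scoped Pointwise in
theorem mem_pow_natAbs (a : Multiplicative ℤ) :
    a ∈ ({Multiplicative.ofAdd 1, Multiplicative.ofAdd (-1)} : Finset (Multiplicative ℤ)) ^
      a.toAdd.natAbs := by
  rcases Int.natAbs_eq a.toAdd with h | h
  · have e : a = Multiplicative.ofAdd (1 : ℤ) ^ a.toAdd.natAbs := by
      rw [← ofAdd_nsmul, nsmul_one, ← h, ofAdd_toAdd]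
    have h := Finset.pow_mem_pow (n := a.toAdd.natAbs) (show Multiplicative.ofAdd 1 ∈
      ({Multiplicative.ofAdd 1, Multiplicative.ofAdd (-1)} : Finset (Multiplicative ℤ)) by simp)
    rwa [← e] at h
  · have e : a = Multiplicative.ofAdd (-1 : ℤ) ^ a.toAdd.natAbs := by
      rw [← ofAdd_nsmul, smul_neg, nsmul_one, ← h, ofAdd_toAdd]
    have h := Finset.pow_mem_pow (n := a.toAdd.natAbs) (show Multiplicative.ofAdd (-1) ∈
      ({Multiplicative.ofAdd 1, Multiplicative.ofAdd (-1)} : Finset (Multiplicative ℤ)) by simp)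
    rwa [← e] at h

open scoped Pointwise in
theorem exists_mem_pow_cyclicWeight :
    ∀ n, ∃ S : Finset (Multiplicative (ZMod n)), ∀ a, a ∈ S ^ cyclicWeight n a
  | 0 => ⟨({Multiplicative.ofAdd 1, Multiplicative.ofAdd (-1)} : Finset (Multiplicative ℤ)),
      mem_pow_natAbs⟩
  | n + 1 => by
    refine ⟨Finset.univ, fun a => ?_⟩
    by_cases h : a = 1 <;> simp [cyclicWeight, h]

/-! ### Words -/

namespace TwoCosets.Word

variable {ι G : Type} [Group G]

/-- The element represented by a letter. -/
def letter (x : ι → G) (l : ι × Bool) : G := if l.2 then x l.1 else (x l.1)⁻¹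

@[simp] theorem eval_nil (x : ι → G) : eval x [] = 1 := rfl

@[simp] theorem eval_cons (x : ι → G) (l : ι × Bool) (w : Word ι) :
    eval x (l :: w) = letter x l * eval x w := rfl

@[simp] theorem eval_append (x : ι → G) (w w' : Word ι) :
    eval x (w ++ w') = eval x w * eval x w' := by
  simp [eval]

theorem map_eval {G' : Type} [Group G'] (f : G →* G') (x : ι → G) (w : Word ι) :
    f (eval x w) = eval (fun i => f (x i)) w := by
  induction w with
  | nil => simp
  | cons l w ih =>
    rw [eval_cons, eval_cons, map_mul, ih, letter, letter]
    split <;> simp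

/-- The formal inverse of a word. -/
def inv (w : Word ι) : Word ι := (w.map fun l => (l.1, !l.2)).reverse

@[simp] theorem eval_inv (x : ι → G) (w : Word ι) : eval x w.inv = (eval x w)⁻¹ := by
  induction w with
  | nil => simp [inv]
  | cons l w ih =>
    have : inv (l :: w) = inv w ++ [(l.1, !l.2)] := by simp [inv]
    rw [this, eval_append, ih, eval_cons x l w, mul_inv_rev]
    cases h : l.2 <;> simp [letter, h]

theorem eval_flatMap {κ : Type} (y : κ → G) (x : ι → G) (σ : ι × Bool → Word κ)
    (hσ : ∀ l, eval y (σ l) = letter x l) (w : Word ι) :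
    eval y (w.flatMap σ) = eval x w := by
  induction w with
  | nil => simp
  | cons l w ih => rw [List.flatMap_cons, eval_append, ih, hσ, eval_cons]

theorem exists_eval_eq (x : ι → G) (hx : Subgroup.closure (Set.range x) = ⊤) (g : G) :
    ∃ w : Word ι, eval x w = g := by
  have hg : g ∈ Subgroup.closure (Set.range x) := hx ▸ Subgroup.mem_top g
  induction hg using Subgroup.closure_induction with
  | mem g hg =>
    obtain ⟨i, rfl⟩ := hg
    exact ⟨[(i, true)], by simp [letter]⟩
  | one => exact ⟨[], rfl⟩
  | mul g h _ _ hg hh =>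
    obtain ⟨w, rfl⟩ := hg
    obtain ⟨w', rfl⟩ := hh
    exact ⟨w ++ w', eval_append x w w'⟩
  | inv g _ hg =>
    obtain ⟨w, rfl⟩ := hg
    exact ⟨w.inv, eval_inv x w⟩

theorem primrec_inv [Primcodable ι] : Primrec (inv : Word ι → Word ι) := by
  refine Primrec.list_reverse.comp (Primrec.list_map Primrec.id ?_)
  exact (Primrec.pair (Primrec.fst.comp Primrec.snd)
    (Primrec.not.comp (Primrec.snd.comp Primrec.snd))).to₂

theorem length_eval_le {ℓ : G → ℕ} (hℓ : IsTreeLength ℓ) [Finite ι] (x : ι → G) :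
    ∃ c, ∀ w : Word ι, ℓ (eval x w) ≤ c * w.length := by
  obtain ⟨c, hc⟩ := (Set.finite_range fun i => ℓ (x i)).bddAbove
  refine ⟨c, fun w => ?_⟩
  induction w with
  | nil => simp [hℓ.one]
  | cons l w ih =>
    have h1 := hℓ.mul_le (letter x l) (eval x w)
    have h2 : ℓ (letter x l) ≤ c := by
      have := hc ⟨l.1, rfl⟩
      simp only [letter]
      split
      · exact this
      · rwa [hℓ.inv]
    rw [eval_cons, List.length_cons, mul_add_one]
    omega

end TwoCosets.Word

/-! ### The word problem in a free product of cyclic groups -/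

namespace CyclicFreeProduct

open Monoid TwoCosets FreeProductLength

variable {J : Type}

/-- The free product of cyclic groups with orders `n i` (infinite where `n i = 0`). -/
abbrev FreeProd (n : J → ℕ) : Type := CoprodI fun i => Multiplicative (ZMod (n i))

/-- The canonical generators of a free product of cyclic groups. -/
def factorGen (n : J → ℕ) (i : J) : FreeProd n :=
  CoprodI.of (M := fun i => Multiplicative (ZMod (n i))) (i := i) (Multiplicative.ofAdd 1)

theorem of_ofAdd_intCast (n : J → ℕ) (i : J) (z : ℤ) :
    CoprodI.of (M := fun i => Multiplicative (ZMod (n i))) (i := i)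
      (Multiplicative.ofAdd (z : ZMod (n i))) = factorGen n i ^ z := by
  rw [factorGen, ← map_zpow, ← ofAdd_zsmul, zsmul_one]

theorem factorGen_pow (n : J → ℕ) (i : J) : factorGen n i ^ n i = 1 := by
  rw [← zpow_natCast, ← of_ofAdd_intCast]
  simp

theorem closure_range_factorGen (n : J → ℕ) : Subgroup.closure (Set.range (factorGen n)) = ⊤ := by
  refine (Subgroup.eq_top_iff' _).2 fun g => ?_
  induction g using CoprodI.induction_on with
  | one => exact one_mem _
  | of i a =>
    obtain ⟨z, hz⟩ := ZMod.intCast_surjective a.toAdd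
    have : a = Multiplicative.ofAdd (z : ZMod (n i)) := by rw [hz, ofAdd_toAdd]
    rw [this, of_ofAdd_intCast]
    exact zpow_mem (Subgroup.subset_closure (Set.mem_range_self i)) z
  | mul x y hx hy => exact mul_mem hx hy

/-- A stack stores syllables `(i, s, k)`, standing for the power `±(k + 1)` of the generator `i`,
the sign being given by `s`. -/
abbrev Stack (J : Type) : Type := List (J × Bool × ℕ)

/-- The exponent of a syllable. -/
def exponent (e : J × Bool × ℕ) : ℤ := if e.2.1 then e.2.2 + 1 else -(e.2.2 + 1)

/-- The syllable of a stack as a syllable of the free product. -/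
def syllable (n : J → ℕ) (e : J × Bool × ℕ) : Σ i, Multiplicative (ZMod (n i)) :=
  ⟨e.1, Multiplicative.ofAdd (exponent e : ZMod (n e.1))⟩

/-- The element represented by a stack. -/
def stackProd (n : J → ℕ) (s : Stack J) : FreeProd n := listProd (s.map (syllable n))

/-- Stacks in normal form. -/
def IsNormal (n : J → ℕ) (s : Stack J) : Prop :=
  (∀ e ∈ s, n e.1 = 0 ∨ e.2.2 + 1 < n e.1) ∧ s.IsChain fun e f => e.1 ≠ f.1

/-- Push a new syllable, with a generator or an inverse generator. -/
def pushNew (n : J → ℕ) (l : J × Bool) (s : Stack J) : Stack J :=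
  if n l.1 = 1 then s else (l.1, l.2, 0) :: s

/-- Multiply the top syllable by one of its letters. -/
def pushTop (n : J → ℕ) (b : Bool) (e : J × Bool × ℕ) (s : Stack J) : Stack J :=
  if e.2.1 = b then if e.2.2 + 2 = n e.1 then s else (e.1, e.2.1, e.2.2 + 1) :: s
  else if e.2.2 = 0 then s else (e.1, e.2.1, e.2.2 - 1) :: s

theorem stackProd_cons (n : J → ℕ) (e : J × Bool × ℕ) (s : Stack J) :
    stackProd n (e :: s) = factorGen n e.1 ^ exponent e * stackProd n s := by
  rw [← of_ofAdd_intCast]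
  rfl

theorem IsNormal.reduced {n : J → ℕ} {s : Stack J} (h : IsNormal n s) :
    Reduced (s.map (syllable n)) := by
  constructor
  · intro t ht
    obtain ⟨e, he, rfl⟩ := List.mem_map.1 ht
    intro h1
    have h2 : ((exponent e : ℤ) : ZMod (n e.1)) = 0 := h1
    rw [CharP.intCast_eq_zero_iff (ZMod (n e.1)) (n e.1)] at h2
    have h3 := Int.natAbs_dvd_natAbs.2 h2
    have h4 : (exponent e).natAbs = e.2.2 + 1 := by
      unfold exponent
      split <;> omega
    rw [h4, Int.natAbs_natCast] at h3
    rcases h.1 e he with h0 | h0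
    · simp [h0] at h3
    · exact absurd (Nat.le_of_dvd (by omega) h3) (by omega)
  · rw [List.isChain_map]
    exact h.2

theorem isNormal_cons {n : J → ℕ} {e : J × Bool × ℕ} {s : Stack J} : IsNormal n (e :: s) ↔
    (n e.1 = 0 ∨ e.2.2 + 1 < n e.1) ∧ (∀ f ∈ s.head?, e.1 ≠ f.1) ∧ IsNormal n s := by
  simp only [IsNormal, List.mem_cons, forall_eq_or_imp, List.isChain_cons]
  tauto

theorem isNormal_pushNew {n : J → ℕ} (l : J × Bool) {s : Stack J} (h : IsNormal n s)
    (hne : ∀ f ∈ s.head?, l.1 ≠ f.1) : IsNormal n (pushNew n l s) := by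
  unfold pushNew
  split
  · exact h
  · exact isNormal_cons.2 ⟨by simp only; omega, hne, h⟩

theorem isNormal_pushTop {n : J → ℕ} (b : Bool) {e : J × Bool × ℕ} {s : Stack J}
    (h : IsNormal n (e :: s)) : IsNormal n (pushTop n b e s) := by
  obtain ⟨h1, h2, h3⟩ := isNormal_cons.1 h
  unfold pushTop
  split_ifs
  · exact h3
  · exact isNormal_cons.2 ⟨by simp only; omega, h2, h3⟩
  · exact h3
  · exact isNormal_cons.2 ⟨by simp only; omega, h2, h3⟩

theorem stackProd_pushNew (n : J → ℕ) (l : J × Bool) (s : Stack J) :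
    stackProd n (pushNew n l s) = Word.letter (factorGen n) l * stackProd n s := by
  unfold pushNew
  split_ifs with h
  · have := factorGen_pow n l.1
    rw [h, pow_one] at this
    simp [Word.letter, this]
  · rw [stackProd_cons]
    unfold exponent Word.letter
    split_ifs <;> simp

theorem stackProd_pushTop (n : J → ℕ) (b : Bool) (e : J × Bool × ℕ) (s : Stack J) :
    stackProd n (pushTop n b e s) = Word.letter (factorGen n) (e.1, b) * stackProd n (e :: s) := by
  obtain ⟨i, c, k⟩ := e
  have hn := factorGen_pow n i
  rw [stackProd_cons, ← mul_assoc]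
  obtain ⟨ε, hε, hl⟩ : ∃ ε : ℤ, ε = (if b then 1 else -1) ∧
      Word.letter (factorGen n) (i, b) = factorGen n i ^ ε := ⟨_, rfl, by cases b <;> simp [Word.letter]⟩
  rw [hl, ← zpow_add]
  unfold pushTop
  simp only
  split_ifs with h1 h2 h2
  · have e1 : ε + exponent (i, c, k) = n i ∨ ε + exponent (i, c, k) = -n i := by
      rw [← h2, hε, ← h1]
      cases c <;> simp [exponent] <;> omega
    rcases e1 with e1 | e1 <;> simp [e1, hn]
  · have e1 : ε + exponent (i, c, k) = exponent (i, c, k + 1) := by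
      rw [hε, ← h1]
      cases c <;> simp [exponent]; omega
    rw [stackProd_cons, e1]
  · have e1 : ε + exponent (i, c, k) = 0 := by
      rw [hε, h2]
      cases b <;> cases c <;> simp_all [exponent]
    rw [e1, zpow_zero, one_mul]
  · have e1 : ε + exponent (i, c, k) = exponent (i, c, k - 1) := by
      have e2 : ((k - 1 : ℕ) : ℤ) = k - 1 := by omega
      simp only [exponent, hε, e2]
      cases b <;> cases c <;> simp_all
    rw [stackProd_cons, e1]

variable [DecidableEq J]

/-- Multiply a stack by a letter. -/
def push (n : J → ℕ) (l : J × Bool) : Stack J → Stack J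
  | [] => pushNew n l []
  | e :: s => if e.1 = l.1 then pushTop n l.2 e s else pushNew n l (e :: s)

/-- The normal form of a word. -/
def normalForm (n : J → ℕ) (w : Word J) : Stack J := w.foldr (push n) []

theorem isNormal_push {n : J → ℕ} (l : J × Bool) {s : Stack J} (h : IsNormal n s) :
    IsNormal n (push n l s) := by
  match s with
  | [] => exact isNormal_pushNew l h (by simp)
  | e :: s =>
    simp only [push]
    split_ifs with he
    · exact isNormal_pushTop l.2 h
    · exact isNormal_pushNew l h (by simpa using fun h => he h.symm)

theorem stackProd_push (n : J → ℕ) (l : J × Bool) (s : Stack J) :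
    stackProd n (push n l s) = Word.letter (factorGen n) l * stackProd n s := by
  match s with
  | [] => exact stackProd_pushNew n l []
  | e :: s =>
    simp only [push]
    split_ifs with h
    · rw [stackProd_pushTop, h]
    · exact stackProd_pushNew n l _

theorem isNormal_normalForm (n : J → ℕ) (w : Word J) : IsNormal n (normalForm n w) := by
  induction w with
  | nil => exact ⟨by simp [normalForm], by simp [normalForm]⟩
  | cons l w ih => exact isNormal_push l ih

theorem stackProd_normalForm (n : J → ℕ) (w : Word J) :
    stackProd n (normalForm n w) = w.eval (factorGen n) := by
  induction w with
  | nil => rfl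
  | cons l w ih => rw [Word.eval_cons, ← ih]; exact stackProd_push n l _

/-- Normal stacks are not unique, since a power k and a power k - n of a generator of order n are
both allowed. But their syllables are nontrivial and adjacent ones lie in different factors, so only
the empty stack represents 1. -/
theorem normalForm_eq_nil_iff (n : J → ℕ) (w : Word J) :
    normalForm n w = [] ↔ w.eval (factorGen n) = 1 := by
  rw [← stackProd_normalForm]
  constructor
  · intro h
    rw [h]
    rfl
  · intro h
    exact List.map_eq_nil_iff.1
      (eq_nil_of_listProd_eq_one (isNormal_normalForm n w).reduced h)

variable [Primcodable J] [Finite J]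

theorem primrec_push (n : J → ℕ) : Primrec fun p : (J × Bool) × Stack J => push n p.1 p.2 := by
  have hn : Primrec n := Primrec.dom_finite n
  have hnew : Primrec fun p : (J × Bool) × Stack J => pushNew n p.1 p.2 := by
    unfold pushNew
    refine Primrec.ite (Primrec.eq.comp (hn.comp (Primrec.fst.comp Primrec.fst))
      (Primrec.const 1)) Primrec.snd ?_
    exact Primrec.list_cons.comp (Primrec.pair (Primrec.fst.comp Primrec.fst)
      (Primrec.pair (Primrec.snd.comp Primrec.fst) (Primrec.const 0))) Primrec.snd
  have htop : Primrec fun p : (Bool × (J × Bool × ℕ)) × Stack J => pushTop n p.1.1 p.1.2 p.2 := by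
    have hi : Primrec fun p : (Bool × (J × Bool × ℕ)) × Stack J => p.1.2.1 :=
      Primrec.fst.comp (Primrec.snd.comp Primrec.fst)
    have hc : Primrec fun p : (Bool × (J × Bool × ℕ)) × Stack J => p.1.2.2.1 :=
      Primrec.fst.comp (Primrec.snd.comp (Primrec.snd.comp Primrec.fst))
    have hk : Primrec fun p : (Bool × (J × Bool × ℕ)) × Stack J => p.1.2.2.2 :=
      Primrec.snd.comp (Primrec.snd.comp (Primrec.snd.comp Primrec.fst))
    unfold pushTop
    refine Primrec.ite (Primrec.eq.comp hc (Primrec.fst.comp Primrec.fst)) ?_ ?_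
    · refine Primrec.ite (Primrec.eq.comp (Primrec.nat_add.comp hk (Primrec.const 2))
        (hn.comp hi)) Primrec.snd ?_
      exact Primrec.list_cons.comp (Primrec.pair hi (Primrec.pair hc (Primrec.succ.comp hk)))
        Primrec.snd
    · refine Primrec.ite (Primrec.eq.comp hk (Primrec.const 0)) Primrec.snd ?_
      exact Primrec.list_cons.comp (Primrec.pair hi (Primrec.pair hc (Primrec.pred.comp hk)))
        Primrec.snd
  have key : Primrec fun p : (J × Bool) × Stack J =>
      List.casesOn (motive := fun _ => Stack J) p.2 (pushNew n p.1 []) fun e s =>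
        if e.1 = p.1.1 then pushTop n p.1.2 e s else pushNew n p.1 (e :: s) := by
    refine Primrec.list_casesOn (f := fun p : (J × Bool) × Stack J => p.2)
      (h := fun p q => if q.1.1 = p.1.1 then pushTop n p.1.2 q.1 q.2
        else pushNew n p.1 (q.1 :: q.2)) Primrec.snd ?_ ?_
    · exact hnew.comp (Primrec.pair Primrec.fst (Primrec.const []))
    · refine Primrec.ite (c := fun r : ((J × Bool) × Stack J) × ((J × Bool × ℕ) × Stack J) =>
        r.2.1.1 = r.1.1.1) ?_ ?_ ?_
      · exact Primrec.eq.comp (Primrec.fst.comp (Primrec.fst.comp Primrec.snd))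
          (Primrec.fst.comp (Primrec.fst.comp Primrec.fst))
      · exact htop.comp (Primrec.pair (Primrec.pair
          (Primrec.snd.comp (Primrec.fst.comp Primrec.fst)) (Primrec.fst.comp Primrec.snd))
          (Primrec.snd.comp Primrec.snd))
      · exact hnew.comp (Primrec.pair (Primrec.fst.comp Primrec.fst)
          (Primrec.list_cons.comp (Primrec.fst.comp Primrec.snd) (Primrec.snd.comp Primrec.snd)))
  refine key.of_eq fun p => ?_
  rcases p with ⟨l, _ | ⟨e, s⟩⟩ <;> rfl

theorem primrec_normalForm (n : J → ℕ) : Primrec (normalForm n) :=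
  Primrec.list_foldr (h := fun _ p => push n p.1 p.2) Primrec.id (Primrec.const [])
    ((primrec_push n).comp Primrec.snd)

theorem primrecPred_eval_factorGen_eq_one (n : J → ℕ) :
    PrimrecPred fun w : Word J => w.eval (factorGen n) = 1 :=
  (Primrec.eq.comp (primrec_normalForm n) (Primrec.const [])).of_eq fun w =>
    normalForm_eq_nil_iff n w

/-- The word problem for a finite family of elements of a free product of cyclic groups is
primitive recursive. -/
theorem primrecPred_eval_eq_one {ι : Type} [Primcodable ι] [Finite ι] (n : J → ℕ)
    (x : ι → FreeProd n) : PrimrecPred fun w : Word ι => w.eval x = 1 := by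
  choose σ hσ using fun l : ι × Bool =>
    Word.exists_eval_eq (factorGen n) (closure_range_factorGen n) (Word.letter x l)
  have hs : Primrec fun w : Word ι => w.flatMap σ :=
    Primrec.list_flatMap Primrec.id ((Primrec.dom_finite σ).comp Primrec.snd)
  exact ((primrecPred_eval_factorGen_eq_one n).comp hs).of_eq fun w => by
    rw [Word.eval_flatMap (factorGen n) x σ hσ]

end CyclicFreeProduct

/-! ### Groups of translations and reflections of the integers -/

namespace TwoCosets.Word

/-- For a finite family of translations of `ℤ` and copies of `z ↦ -z`, it is primitive recursive
whether a word fixes `0`. -/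
theorem primrecPred_eval_zero {ι : Type} [Primcodable ι] [Finite ι] (x : ι → Equiv.Perm ℤ)
    (hx : ∀ i, (∃ t, ∀ z, x i z = z + t) ∨ ∀ z, x i z = -z) :
    PrimrecPred fun w : Word ι => w.eval x 0 = 0 := by
  -- An integer is stored as a difference p - q of naturals, not reduced: a reflection swaps p and
  -- q, a translation adds to each of them. Its value is 0 exactly when p = q.
  have hletter (l : ι × Bool) : ∃ r : Bool × ℕ × ℕ, ∀ p q : ℕ,
      letter x l (p - q) = if r.1 then (q : ℤ) - p else ((p + r.2.1 : ℕ) : ℤ) - (q + r.2.2 : ℕ) := by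
    have hinv (z z' : ℤ) (h : x l.1 z' = z) : (x l.1)⁻¹ z = z' := by
      exact Equiv.Perm.inv_eq_iff_eq.2 h.symm
    rcases hx l.1 with ⟨t, ht⟩ | ht
    · by_cases hl : l.2
      · refine ⟨(false, t.toNat, (-t).toNat), fun p q => ?_⟩
        simp only [letter, hl, if_true, ht]
        push_cast
        simp
        omega
      · refine ⟨(false, (-t).toNat, t.toNat), fun p q => ?_⟩
        simp only [letter, hl]
        refine hinv _ _ ?_
        rw [ht]
        push_cast
        simp
        omega
    · refine ⟨(true, 0, 0), fun p q => ?_⟩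
      by_cases hl : l.2
      · simp [letter, hl, ht]
      · simp only [letter, hl]
        refine hinv _ _ ?_
        rw [ht]
        simp
  choose r hr using hletter
  let step (l : ι × Bool) (s : ℕ × ℕ) : ℕ × ℕ :=
    if (r l).1 then (s.2, s.1) else (s.1 + (r l).2.1, s.2 + (r l).2.2)
  let state (w : Word ι) : ℕ × ℕ := w.foldr step (0, 0)
  have hstate (w : Word ι) : w.eval x 0 = ((state w).1 : ℤ) - (state w).2 := by
    induction w with
    | nil => simp [state]
    | cons l w ih =>
      have e : state (l :: w) = step l (state w) := rfl
      rw [eval_cons, Equiv.Perm.mul_apply, ih, hr, e]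
      simp only [step]
      split_ifs <;> simp
  have hr' : Primrec r := Primrec.dom_finite r
  have hrc : Primrec fun p : (ι × Bool) × (ℕ × ℕ) => r p.1 := hr'.comp Primrec.fst
  have h1 : Primrec fun p : (ι × Bool) × (ℕ × ℕ) => p.2.1 := Primrec.fst.comp Primrec.snd
  have h2 : Primrec fun p : (ι × Bool) × (ℕ × ℕ) => p.2.2 := Primrec.snd.comp Primrec.snd
  have hstep : Primrec fun p : (ι × Bool) × (ℕ × ℕ) => step p.1 p.2 := by
    refine Primrec.ite (Primrec.eq.comp (Primrec.fst.comp hrc) (Primrec.const true))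
      (Primrec.pair h2 h1) (Primrec.pair ?_ ?_)
    · exact Primrec.nat_add.comp h1 (Primrec.fst.comp (Primrec.snd.comp hrc))
    · exact Primrec.nat_add.comp h2 (Primrec.snd.comp (Primrec.snd.comp hrc))
  have hst : Primrec state :=
    Primrec.list_foldr (h := fun _ p => step p.1 p.2) Primrec.id (Primrec.const (0, 0))
      (hstep.comp Primrec.snd)
  refine (Primrec.eq.comp (Primrec.fst.comp hst) (Primrec.snd.comp hst)).of_eq fun w => ?_
  rw [hstate]
  omega

end TwoCosets.Word

/-! ### The structure of the set of solutions -/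

section Solutions

variable {G : Type} [Group G]

theorem Subgroup.mem_closure_pair_of_commute {d h : G} (hc : Commute d h) {g : G} :
    g ∈ Subgroup.closure {d, h} ↔ ∃ m i : ℤ, g = d ^ m * h ^ i := by
  constructor
  · intro hg
    induction hg using Subgroup.closure_induction with
    | mem g hg =>
      rcases hg with rfl | rfl
      · exact ⟨1, 0, by simp⟩
      · exact ⟨0, 1, by simp⟩
    | one => exact ⟨0, 0, by simp⟩
    | mul g g' _ _ hg hg' =>
      obtain ⟨m, i, rfl⟩ := hg
      obtain ⟨m', i', rfl⟩ := hg'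
      refine ⟨m + m', i + i', ?_⟩
      rw [zpow_add, zpow_add, mul_assoc, mul_assoc, ← mul_assoc (h ^ i),
        ← (hc.zpow_zpow m' i).eq, mul_assoc]
    | inv g _ hg =>
      obtain ⟨m, i, rfl⟩ := hg
      exact ⟨-m, -i, by rw [mul_inv_rev, zpow_neg, zpow_neg,
        ((hc.zpow_zpow m i).inv_inv).eq]⟩
  · rintro ⟨m, i, rfl⟩
    exact mul_mem (zpow_mem (Subgroup.subset_closure (by simp)) m)
      (zpow_mem (Subgroup.subset_closure (by simp)) i)

theorem commute_of_mem_closure_pair {d h : G} (hc : Commute d h) {x y : G}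
    (hx : x ∈ Subgroup.closure {d, h}) (hy : y ∈ Subgroup.closure {d, h}) : x * y = y * x := by
  obtain ⟨m, i, rfl⟩ := (Subgroup.mem_closure_pair_of_commute hc).1 hx
  obtain ⟨m', i', rfl⟩ := (Subgroup.mem_closure_pair_of_commute hc).1 hy
  have h1 : Commute (d ^ m) (d ^ m' * h ^ i') :=
    ((Commute.refl d).zpow_zpow m m').mul_right (hc.zpow_zpow m i')
  have h2 : Commute (h ^ i) (d ^ m' * h ^ i') :=
    (hc.symm.zpow_zpow i m').mul_right ((Commute.refl h).zpow_zpow i i')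
  exact (h1.mul_left h2).eq

theorem zpowers_mul_mem_iff {h g g' : G} : g⁻¹ * g' ∈ Subgroup.zpowers h ↔
    ∃ j : ℤ, g = g' * h ^ j := by
  rw [Subgroup.mem_zpowers_iff]
  constructor
  · rintro ⟨j, hj⟩
    refine ⟨-j, ?_⟩
    rw [zpow_neg, hj]
    group
  · rintro ⟨j, rfl⟩
    refine ⟨-j, ?_⟩
    rw [zpow_neg]
    group

variable {d d' h : G}

/-- The power of h in c moves past v d'^n by normality of ⟨h⟩ and is absorbed into T', which
contains h. So only the exponents of d and d' matter. -/
theorem exists_mem_zpowers_iff_solutions_nonempty (hd : Commute d h) (hd' : Commute d' h)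
    (hn : ∀ g i, ∃ j : ℤ, h ^ (i : ℤ) * g = g * h ^ j) (u v : G) :
    (∃ m n : ℤ, u⁻¹ * (d ^ m * v * d' ^ n) ∈ Subgroup.zpowers h) ↔
      (TwoCosets.solutions (Subgroup.closure {d, h}) (Subgroup.closure {d', h}) u v).Nonempty := by
  constructor
  · rintro ⟨m, n, hmn⟩
    obtain ⟨j, hj⟩ := zpowers_mul_mem_iff.1 hmn
    refine ⟨(d ^ m, d' ^ n * h ^ j), ?_, ?_, ?_⟩
    · exact (Subgroup.mem_closure_pair_of_commute hd).2 ⟨m, 0, by simp⟩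
    · exact (Subgroup.mem_closure_pair_of_commute hd').2 ⟨n, j, rfl⟩
    · simpa [mul_assoc] using hj
  · rintro ⟨⟨c, c'⟩, hc, hc', hu⟩
    obtain ⟨m, i, rfl⟩ := (Subgroup.mem_closure_pair_of_commute hd).1 hc
    obtain ⟨n, j, rfl⟩ := (Subgroup.mem_closure_pair_of_commute hd').1 hc'
    obtain ⟨k, hk⟩ := hn (v * d' ^ n) i
    refine ⟨m, n, zpowers_mul_mem_iff.2 ⟨k + j, ?_⟩⟩
    calc u = d ^ m * (h ^ i * (v * d' ^ n)) * h ^ j := by rw [hu]; group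
      _ = _ := by rw [hk]; group

/-- Rewrites periods modulo ⟨h⟩ as membership in a subgroup; the exponents that are periods thus
form a subgroup of ℤ. -/
theorem exists_mem_zpowers_iff_mem_closure (hd' : Commute d' h) (v g : G) :
    (∃ n : ℤ, v⁻¹ * (g * v * d' ^ n) ∈ Subgroup.zpowers h) ↔
      v⁻¹ * g * v ∈ Subgroup.closure {d', h} := by
  rw [Subgroup.mem_closure_pair_of_commute hd']
  constructor
  · rintro ⟨n, hmem⟩
    obtain ⟨j, hj⟩ := Subgroup.mem_zpowers_iff.1 hmem
    refine ⟨-n, j, ?_⟩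
    rw [(hd'.zpow_zpow (-n) j).eq, hj, zpow_neg]
    group
  · rintro ⟨n, j, hnj⟩
    refine ⟨-n, Subgroup.mem_zpowers_iff.2 ⟨j, ?_⟩⟩
    rw [← mul_assoc, ← mul_assoc, hnj, (hd'.zpow_zpow n j).eq, zpow_neg, mul_inv_cancel_right]

/-- Division with remainder: `r` is the nonnegative generator of the group of periods. The value r =
0 encodes that there is no positive period, and then divisibility forces m = 0. -/
theorem dvd_of_minimal_period {T : Subgroup G} {v : G} {r : ℕ} (hr : v⁻¹ * d ^ r * v ∈ T)
    (hmin : ∀ m : ℕ, 0 < m → (r = 0 ∨ m < r) → v⁻¹ * d ^ m * v ∉ T) (m : ℤ)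
    (hm : v⁻¹ * d ^ m * v ∈ T) : (r : ℤ) ∣ m := by
  have hmod : v⁻¹ * d ^ (m % r) * v ∈ T := by
    have e : v⁻¹ * d ^ (m % r) * v = (v⁻¹ * d ^ m * v) * (v⁻¹ * d ^ r * v) ^ (-(m / r)) := by
      have e1 : (v⁻¹ * d ^ r * v) ^ (-(m / r)) = v⁻¹ * (d ^ r) ^ (-(m / r)) * v := by
        have := conj_zpow (a := v⁻¹) (b := d ^ r) (i := -(m / r))
        rwa [inv_inv] at this
      rw [e1, Int.emod_def, sub_eq_add_neg, zpow_add, ← mul_neg, zpow_mul, zpow_natCast]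
      group
    rw [e]
    exact mul_mem hm (zpow_mem hr _)
  rcases Nat.eq_zero_or_pos r with h0 | h0
  · subst h0
    have habs : v⁻¹ * d ^ m.natAbs * v ∈ T := by
      rcases Int.natAbs_eq m with h | h
      · rwa [h, zpow_natCast] at hm
      · rw [h, zpow_neg, zpow_natCast] at hm
        have := inv_mem hm
        rwa [show (v⁻¹ * (d ^ m.natAbs)⁻¹ * v)⁻¹ = v⁻¹ * d ^ m.natAbs * v by group] at this
    by_contra hne
    refine hmin m.natAbs (Int.natAbs_pos.2 fun h => hne (by simp [h])) (Or.inl rfl) habs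
  · have hnn := Int.emod_nonneg m (b := r) (by omega)
    have hlt := Int.emod_lt_of_pos m (b := r) (by omega)
    obtain ⟨k, hk⟩ := Int.eq_ofNat_of_zero_le hnn
    rw [hk, zpow_natCast] at hmod
    by_contra hne
    refine hmin k ?_ (Or.inr (by omega)) hmod
    rcases Nat.eq_zero_or_pos k with rfl | h
    · exact absurd (Int.dvd_of_emod_eq_zero hk) hne
    · exact h

/-- Commutativity of T' makes the solutions a coset of the group S of pairs fixing v. The first
coordinate of an element of S is d^m h^i, where r divides m, and it determines the second
coordinate. -/
theorem solutions_eq_coset (hd : Commute d h) (hd' : Commute d' h)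
    (hn : ∀ g i, ∃ j : ℤ, h ^ (i : ℤ) * g = g * h ^ j) {u v c c' s : G} {r : ℕ}
    (hc : c ∈ Subgroup.closure {d, h}) (hc' : c' ∈ Subgroup.closure {d', h})
    (hu : u = c * v * c') (hs : s ∈ Subgroup.closure {d', h}) (hv : v = d ^ r * v * s)
    (hmin : ∀ m : ℕ, 0 < m → (r = 0 ∨ m < r) → v⁻¹ * d ^ m * v ∉ Subgroup.closure {d', h}) :
    TwoCosets.solutions (Subgroup.closure {d, h}) (Subgroup.closure {d', h}) u v =
      {z | ∃ t ∈ Subgroup.closure {(h, v⁻¹ * h⁻¹ * v), (d ^ r, s)}, z = (c, c') * t} := by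
  set T := Subgroup.closure {d, h} with hT
  set T' := Subgroup.closure {d', h} with hT'
  have hdT : d ∈ T := Subgroup.subset_closure (by simp)
  have hhT : h ∈ T := Subgroup.subset_closure (by simp)
  have hhT' : v⁻¹ * h⁻¹ * v ∈ T' := by
    obtain ⟨j, hj⟩ := hn v (-1)
    have e : v⁻¹ * h⁻¹ * v = h ^ j := by
      rw [mul_assoc, ← zpow_neg_one h, hj, inv_mul_cancel_left]
    rw [e]
    exact zpow_mem (Subgroup.subset_closure (by simp)) j
  let S : Subgroup (G × G) :=
    { carrier := {z | z.1 ∈ T ∧ z.2 ∈ T' ∧ v = z.1 * v * z.2}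
      one_mem' := ⟨one_mem _, one_mem _, by simp⟩
      mul_mem' := by
        rintro ⟨a, a'⟩ ⟨b, b'⟩ ⟨h1, h1', h1e⟩ ⟨h2, h2', h2e⟩
        refine ⟨mul_mem h1 h2, mul_mem h1' h2', ?_⟩
        simp only [Prod.fst_mul, Prod.snd_mul] at *
        rw [commute_of_mem_closure_pair hd' h1' h2']
        calc v = a * (b * v * b') * a' := by rw [← h2e]; exact h1e
          _ = _ := by group
      inv_mem' := by
        rintro ⟨a, a'⟩ ⟨h1, h1', h1e⟩
        refine ⟨inv_mem h1, inv_mem h1', ?_⟩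
        simp only [Prod.fst_inv, Prod.snd_inv] at *
        conv_rhs => rw [h1e]
        group }
  have hS : Subgroup.closure {(h, v⁻¹ * h⁻¹ * v), (d ^ r, s)} ≤ S := by
    rw [Subgroup.closure_le]
    rintro z (rfl | rfl)
    · exact ⟨hhT, hhT', by group⟩
    · exact ⟨pow_mem hdT r, hs, hv⟩
  ext ⟨a, a'⟩
  constructor
  · rintro ⟨ha, ha', hua⟩
    simp only at ha ha' hua
    refine ⟨(c⁻¹ * a, c'⁻¹ * a'), ?_, by simp⟩
    obtain ⟨m, i, hmi⟩ := (Subgroup.mem_closure_pair_of_commute hd).1 (mul_mem (inv_mem hc) ha)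
    have ha'' : c'⁻¹ * a' ∈ T' := mul_mem (inv_mem hc') ha'
    have hve : v = (c⁻¹ * a) * v * (c'⁻¹ * a') := by
      rw [commute_of_mem_closure_pair hd' (inv_mem hc') ha']
      calc v = c⁻¹ * u * c'⁻¹ := by rw [hu]; group
        _ = _ := by rw [hua]; group
    have hrr : v⁻¹ * d ^ r * v ∈ T' := by
      have : v⁻¹ * d ^ r * v = s⁻¹ := by
        rw [eq_inv_iff_mul_eq_one]
        calc v⁻¹ * d ^ r * v * s = v⁻¹ * (d ^ r * v * s) := by group
          _ = 1 := by rw [← hv, inv_mul_cancel]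
      rw [this]
      exact inv_mem hs
    have hdm : v⁻¹ * d ^ m * v ∈ T' := by
      have e : v⁻¹ * d ^ m * v = (c'⁻¹ * a')⁻¹ * (v⁻¹ * h⁻¹ * v) ^ i := by
        have e1 : (v⁻¹ * h⁻¹ * v) ^ i = v⁻¹ * h⁻¹ ^ i * v := by
          have := conj_zpow (a := v⁻¹) (b := h⁻¹) (i := i)
          rwa [inv_inv] at this
        have e2 : c'⁻¹ * a' = v⁻¹ * (h ^ i)⁻¹ * (d ^ m)⁻¹ * v := by
          calc c'⁻¹ * a' = v⁻¹ * (c⁻¹ * a)⁻¹ * (c⁻¹ * a * v * (c'⁻¹ * a')) := by group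
            _ = v⁻¹ * (c⁻¹ * a)⁻¹ * v := by rw [← hve]
            _ = _ := by rw [hmi]; group
        rw [e1, e2, inv_zpow]
        group
      rw [e]
      exact mul_mem (inv_mem ha'') (zpow_mem hhT' i)
    obtain ⟨k, rfl⟩ := dvd_of_minimal_period hrr hmin m hdm
    -- This product has first coordinate c⁻¹a and lies in S, so cancelling in v = z v z' forces its
    -- second coordinate to be c'⁻¹a'.
    have hgen : (d ^ r, s) ^ k * (h, v⁻¹ * h⁻¹ * v) ^ i ∈
        Subgroup.closure {(h, v⁻¹ * h⁻¹ * v), (d ^ r, s)} :=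
      mul_mem (zpow_mem (Subgroup.subset_closure (by simp)) k)
        (zpow_mem (Subgroup.subset_closure (by simp)) i)
    convert hgen using 1
    have h1 := hS hgen
    obtain ⟨-, -, h3⟩ := h1
    have hfst : ((d ^ r, s) ^ k * (h, v⁻¹ * h⁻¹ * v) ^ i).1 = c⁻¹ * a := by
      rw [hmi, zpow_mul, zpow_natCast]
      simp
    refine Prod.ext hfst.symm ?_
    rw [hfst] at h3
    exact mul_left_cancel (hve.symm.trans h3)
  · rintro ⟨⟨t, t'⟩, ht, heq⟩
    obtain ⟨h1, h2, h3⟩ := hS ht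
    simp only at h1 h2 h3
    obtain ⟨rfl, rfl⟩ : a = c * t ∧ a' = c' * t' := by simpa using heq
    refine ⟨mul_mem hc h1, mul_mem hc' h2, ?_⟩
    simp only
    rw [commute_of_mem_closure_pair hd' hc' h2, hu]
    conv_lhs => rw [h3]
    group

end Solutions

/-! ### The algorithm -/

/-- Unbounded search through the codes of elements of β; it terminates because a witness always
exists. -/
theorem exists_computable_choice {α β : Type} [Primcodable α] [Primcodable β] {P : α → β → Prop}
    (hP : PrimrecRel P) (h : ∀ a, ∃ b, P a b) : ∃ f : α → β, Computable f ∧ ∀ a, P a (f a) := by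
  classical
  let g (a : α) (n : ℕ) : Option β :=
    (Encodable.decode (α := β) n).bind fun b => if P a b then some b else none
  have hg : Primrec₂ g := by
    refine Primrec.option_bind (Primrec.decode.comp Primrec.snd) ?_
    exact Primrec.ite (hP.comp (Primrec.fst.comp Primrec.fst) Primrec.snd)
      (Primrec.option_some.comp Primrec.snd) (Primrec.const none)
  have hpart : Partrec fun a => Nat.rfindOpt (g a) := Partrec.rfindOpt hg.to_comp
  have hdom (a : α) : (Nat.rfindOpt (g a)).Dom := by
    obtain ⟨b, hb⟩ := h a
    exact Nat.rfindOpt_dom.2 ⟨Encodable.encode b, b, by simp [g, hb]⟩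
  refine ⟨fun a => (Nat.rfindOpt (g a)).get (hdom a),
    hpart.of_eq fun a => (Part.some_get (hdom a)).symm, fun a => ?_⟩
  obtain ⟨n, hn⟩ := Nat.rfindOpt_spec (Part.get_mem (hdom a))
  simp only [g, Option.mem_def, Option.bind_eq_some_iff] at hn
  obtain ⟨b, -, hb⟩ := hn
  split_ifs at hb with hp
  have e : b = (Nat.rfindOpt (g a)).get (hdom a) := Option.some.inj hb
  change P a ((Nat.rfindOpt (g a)).get (hdom a))
  rwa [← e]

/-! ### Bounded searches over exponents, expressed through words -/

namespace TwoCosets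

/-- Pairs `(p, q)` such that the differences `p - q` cover the integers of absolute value at most
`N`. -/
def differences (N : ℕ) : List (ℕ × ℕ) :=
  ((List.range (N + 1)).map fun a => (a, 0)) ++ (List.range (N + 1)).map fun a => (0, a)

theorem exists_mem_differences {N : ℕ} {z : ℤ} (hz : z.natAbs ≤ N) :
    ∃ p ∈ differences N, z = (p.1 : ℤ) - p.2 := by
  rcases Int.natAbs_eq z with h | h
  · exact ⟨(z.natAbs, 0), by simp [differences]; omega, by simpa using h⟩
  · exact ⟨(0, z.natAbs), by simp [differences]; omega, by simpa using h⟩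

theorem primrec_differences : Primrec differences := by
  have h : Primrec fun N => List.range (N + 1) := Primrec.list_range.comp Primrec.succ
  exact Primrec.list_append.comp
    (Primrec.list_map h (Primrec.pair Primrec.snd (Primrec.const 0)).to₂)
    (Primrec.list_map h (Primrec.pair (Primrec.const 0) Primrec.snd).to₂)

namespace Word

variable {ι G : Type} [Group G]

/-- The power of a word with exponent the difference of two natural numbers. -/
def power (w : Word ι) (p : ℕ × ℕ) : Word ι :=
  ((List.range p.1).flatMap fun _ => w) ++ (List.range p.2).flatMap fun _ => w.inv

theorem eval_power (x : ι → G) (w : Word ι) (p : ℕ × ℕ) :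
    (w.power p).eval x = w.eval x ^ ((p.1 : ℤ) - p.2) := by
  have h (w : Word ι) (n : ℕ) :
      eval x ((List.range n).flatMap fun _ => w) = w.eval x ^ n := by
    induction n with
    | zero => simp
    | succ n ih => simp [List.range_succ, ih, pow_succ]
  rw [power, eval_append, h, h, eval_inv, zpow_sub, zpow_natCast, zpow_natCast, inv_pow]

theorem primrec_power [Primcodable ι] (w : Word ι) : Primrec w.power :=
  Primrec.list_append.comp
    (Primrec.list_flatMap (Primrec.list_range.comp Primrec.fst) (Primrec.const w).to₂)
    (Primrec.list_flatMap (Primrec.list_range.comp Primrec.snd) (Primrec.const w.inv).to₂)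

end Word

variable {ι G : Type} [Group G]

/-- The word representing `u⁻¹ * d ^ p * v * d' ^ q`. -/
def equationWord (d d' u v : Word ι) (p q : ℕ × ℕ) : Word ι :=
  u.inv ++ (d.power p ++ v ++ d'.power q)

theorem eval_equationWord (x : ι → G) (d d' u v : Word ι) (p q : ℕ × ℕ) :
    (equationWord d d' u v p q).eval x = (u.eval x)⁻¹ *
      (d.eval x ^ ((p.1 : ℤ) - p.2) * v.eval x * d'.eval x ^ ((q.1 : ℤ) - q.2)) := by
  simp [equationWord, Word.eval_power, mul_assoc]

variable [Primcodable ι]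

theorem primrec_equationWord (d d' : Word ι) {α : Type} [Primcodable α] {u v : α → Word ι}
    {p q : α → ℕ × ℕ} (hu : Primrec u) (hv : Primrec v) (hp : Primrec p) (hq : Primrec q) :
    Primrec fun a => equationWord d d' (u a) (v a) (p a) (q a) :=
  Primrec.list_append.comp (Word.primrec_inv.comp hu)
    (Primrec.list_append.comp (Primrec.list_append.comp ((Word.primrec_power d).comp hp) hv)
      ((Word.primrec_power d').comp hq))

/-- The data that the search for a solution has to produce: whether there is one, and exponents. -/
abbrev SolutionData : Type := Bool × (ℕ × ℕ) × (ℕ × ℕ) × (ℕ × ℕ)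

/-- The data that the search for a period has to produce. -/
abbrev PeriodData : Type := ℕ × (ℕ × ℕ) × (ℕ × ℕ)

/-- The bound N makes solvability modulo ⟨h⟩ a finite check, so that insolubility can be certified
too. In the soluble case the exponent of h is found by unbounded search and verified through the
word problem. -/
theorem exists_computable_solution (x : ι → G) (d d' wh : Word ι)
    (hwp : PrimrecPred fun w : Word ι => w.eval x = 1)
    (hker : PrimrecPred fun w : Word ι => w.eval x ∈ Subgroup.zpowers (wh.eval x))
    {N : ℕ → ℕ} (hN : Primrec N)
    (hsol : ∀ (u v : Word ι) (m n : ℤ), (u.eval x)⁻¹ * (d.eval x ^ m * v.eval x * d'.eval x ^ n) ∈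
      Subgroup.zpowers (wh.eval x) → ∃ m' n' : ℤ, m'.natAbs ≤ N (u.length + v.length) ∧
        n'.natAbs ≤ N (u.length + v.length) ∧ (u.eval x)⁻¹ *
          (d.eval x ^ m' * v.eval x * d'.eval x ^ n') ∈ Subgroup.zpowers (wh.eval x)) :
    ∃ f : Word ι × Word ι → SolutionData, Computable f ∧ ∀ u v,
      (((f (u, v)).1 = false) ∧ ¬ ∃ m n : ℤ, (u.eval x)⁻¹ *
        (d.eval x ^ m * v.eval x * d'.eval x ^ n) ∈ Subgroup.zpowers (wh.eval x)) ∨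
      ((f (u, v)).1 = true ∧ u.eval x = (d.power (f (u, v)).2.1).eval x * v.eval x *
        (d'.power (f (u, v)).2.2.1 ++ wh.power (f (u, v)).2.2.2).eval x) := by
  let R (y : Word ι × Word ι) : Prop :=
    ∃ p ∈ differences (N (y.1.length + y.2.length)),
      ∃ q ∈ differences (N (y.1.length + y.2.length)),
        (equationWord d d' y.1 y.2 p q).eval x ∈ Subgroup.zpowers (wh.eval x)
  have hRprim : PrimrecPred R := by
    have hL : Primrec fun y : Word ι × Word ι => differences (N (y.1.length + y.2.length)) :=
      primrec_differences.comp (hN.comp (Primrec.nat_add.comp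
        (Primrec.list_length.comp Primrec.fst) (Primrec.list_length.comp Primrec.snd)))
    have h0 : PrimrecRel fun (q : ℕ × ℕ) (z : (ℕ × ℕ) × (Word ι × Word ι)) =>
        (equationWord d d' z.2.1 z.2.2 z.1 q).eval x ∈ Subgroup.zpowers (wh.eval x) :=
      hker.comp (primrec_equationWord d d'
        (Primrec.fst.comp (Primrec.snd.comp Primrec.snd))
        (Primrec.snd.comp (Primrec.snd.comp Primrec.snd))
        (Primrec.fst.comp Primrec.snd) Primrec.fst)
    have h1 : PrimrecRel fun (p : ℕ × ℕ) (y : Word ι × Word ι) =>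
        ∃ q ∈ differences (N (y.1.length + y.2.length)),
          (equationWord d d' y.1 y.2 p q).eval x ∈ Subgroup.zpowers (wh.eval x) :=
      h0.exists_mem_list.comp (hL.comp Primrec.snd) (Primrec.pair Primrec.fst Primrec.snd)
    exact h1.exists_mem_list.comp hL Primrec.id
  have hR (u v : Word ι) : R (u, v) ↔ ∃ m n : ℤ, (u.eval x)⁻¹ *
        (d.eval x ^ m * v.eval x * d'.eval x ^ n) ∈ Subgroup.zpowers (wh.eval x) := by
    constructor
    · rintro ⟨p, -, q, -, h⟩
      rw [eval_equationWord] at h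
      exact ⟨_, _, h⟩
    · rintro ⟨m, n, h⟩
      obtain ⟨m', n', hm, hn, h'⟩ := hsol u v m n h
      obtain ⟨p, hp, rfl⟩ := exists_mem_differences hm
      obtain ⟨q, hq, rfl⟩ := exists_mem_differences hn
      exact ⟨p, hp, q, hq, by rwa [eval_equationWord]⟩
  -- A primitive recursive test of an answer: either the finite search fails, or the exponents solve
  -- the equation exactly in G and not just modulo ⟨h⟩.
  let P (y : Word ι × Word ι) (o : SolutionData) : Prop :=
    (o.1 = false ∧ ¬ R y) ∨ (o.1 = true ∧
      (equationWord d d' y.1 y.2 o.2.1 o.2.2.1 ++ wh.power o.2.2.2).eval x = 1)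
  have hP : PrimrecRel P := by
    have h1 : Primrec fun z : (Word ι × Word ι) × SolutionData => z.2.1 :=
      Primrec.fst.comp Primrec.snd
    have h2 : Primrec fun z : (Word ι × Word ι) × SolutionData => z.2.2.1 :=
      Primrec.fst.comp (Primrec.snd.comp Primrec.snd)
    have h3 : Primrec fun z : (Word ι × Word ι) × SolutionData => z.2.2.2.1 :=
      Primrec.fst.comp (Primrec.snd.comp (Primrec.snd.comp Primrec.snd))
    have h4 : Primrec fun z : (Word ι × Word ι) × SolutionData => z.2.2.2.2 :=
      Primrec.snd.comp (Primrec.snd.comp (Primrec.snd.comp Primrec.snd))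
    refine PrimrecPred.or (PrimrecPred.and (Primrec.eq.comp h1 (Primrec.const false))
      (hRprim.not.comp Primrec.fst))
      (PrimrecPred.and (Primrec.eq.comp h1 (Primrec.const true)) (hwp.comp ?_))
    exact Primrec.list_append.comp (primrec_equationWord d d' (Primrec.fst.comp Primrec.fst)
      (Primrec.snd.comp Primrec.fst) h2 h3) ((Word.primrec_power wh).comp h4)
  have hex (y : Word ι × Word ι) : ∃ o, P y o := by
    by_cases h : R y
    · obtain ⟨p, -, q, -, hpq⟩ := h
      obtain ⟨j, hj⟩ := Subgroup.mem_zpowers_iff.1 (inv_mem hpq)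
      obtain ⟨k, -, rfl⟩ := exists_mem_differences (le_refl j.natAbs)
      exact ⟨(true, p, q, k), Or.inr ⟨rfl, by
        rw [Word.eval_append, Word.eval_power, hj, mul_inv_cancel]⟩⟩
    · exact ⟨(false, (0, 0), (0, 0), (0, 0)), Or.inl ⟨rfl, h⟩⟩
  obtain ⟨f, hf, hfP⟩ := exists_computable_choice hP hex
  refine ⟨f, hf, fun u v => ?_⟩
  rcases hfP (u, v) with ⟨h1, h2⟩ | ⟨h1, h2⟩
  · exact Or.inl ⟨h1, fun h => h2 ((hR u v).2 h)⟩
  · refine Or.inr ⟨h1, ?_⟩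
    rw [equationWord, List.append_assoc, Word.eval_append, Word.eval_inv,
      inv_mul_eq_one] at h2
    rw [h2]
    simp [mul_assoc]

/-- Minimality need only be tested for exponents up to M, since any positive period entails one in
that range; the bound N makes each such test finite. The exponent 0 is returned when there is no
positive period. -/
theorem exists_computable_period (x : ι → G) (d d' wh : Word ι)
    (hwp : PrimrecPred fun w : Word ι => w.eval x = 1)
    (hker : PrimrecPred fun w : Word ι => w.eval x ∈ Subgroup.zpowers (wh.eval x))
    {M N : ℕ → ℕ} (hM : Primrec M) (hN : Primrec N)
    (hper : ∀ (v : Word ι) (m : ℕ) (n : ℤ), 0 < m →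
      (v.eval x)⁻¹ * (d.eval x ^ m * v.eval x * d'.eval x ^ n) ∈ Subgroup.zpowers (wh.eval x) →
      ∃ (m' : ℕ) (n' : ℤ), 0 < m' ∧ m' ≤ M v.length ∧ (v.eval x)⁻¹ *
        (d.eval x ^ m' * v.eval x * d'.eval x ^ n') ∈ Subgroup.zpowers (wh.eval x))
    (hbd : ∀ (v : Word ι) (m : ℕ) (n : ℤ), m ≤ M v.length →
      (v.eval x)⁻¹ * (d.eval x ^ m * v.eval x * d'.eval x ^ n) ∈ Subgroup.zpowers (wh.eval x) →
      ∃ n' : ℤ, n'.natAbs ≤ N v.length ∧ (v.eval x)⁻¹ *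
        (d.eval x ^ m * v.eval x * d'.eval x ^ n') ∈ Subgroup.zpowers (wh.eval x)) :
    ∃ f : Word ι → PeriodData, Computable f ∧ ∀ v,
      v.eval x = d.eval x ^ (f v).1 * v.eval x *
        (d'.power (f v).2.1 ++ wh.power (f v).2.2).eval x ∧
      ∀ m : ℕ, 0 < m → ((f v).1 = 0 ∨ m < (f v).1) → ¬ ∃ n : ℤ, (v.eval x)⁻¹ *
        (d.eval x ^ m * v.eval x * d'.eval x ^ n) ∈ Subgroup.zpowers (wh.eval x) := by
  let R (m : ℕ) (v : Word ι) : Prop := ∃ q ∈ differences (N v.length),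
    (equationWord d d' v v (m, 0) q).eval x ∈ Subgroup.zpowers (wh.eval x)
  have hRprim : PrimrecRel R := by
    have h0 : PrimrecRel fun (q : ℕ × ℕ) (z : ℕ × Word ι) =>
        (equationWord d d' z.2 z.2 (z.1, 0) q).eval x ∈ Subgroup.zpowers (wh.eval x) :=
      hker.comp (primrec_equationWord d d' (Primrec.snd.comp Primrec.snd)
        (Primrec.snd.comp Primrec.snd)
        (Primrec.pair (Primrec.fst.comp Primrec.snd) (Primrec.const 0)) Primrec.fst)
    exact h0.exists_mem_list.comp (primrec_differences.comp
      (hN.comp (Primrec.list_length.comp Primrec.snd))) Primrec.id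
  have hR (m : ℕ) (v : Word ι) (h : R m v) : ∃ n : ℤ, (v.eval x)⁻¹ *
      (d.eval x ^ m * v.eval x * d'.eval x ^ n) ∈ Subgroup.zpowers (wh.eval x) := by
    obtain ⟨q, -, h⟩ := h
    rw [eval_equationWord] at h
    exact ⟨_, by simpa using h⟩
  have hR' (m : ℕ) (v : Word ι) (hm : m ≤ M v.length) (n : ℤ) (h : (v.eval x)⁻¹ *
      (d.eval x ^ m * v.eval x * d'.eval x ^ n) ∈ Subgroup.zpowers (wh.eval x)) : R m v := by
    obtain ⟨n', hn, h'⟩ := hbd v m n hm h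
    obtain ⟨q, hq, rfl⟩ := exists_mem_differences hn
    exact ⟨q, hq, by rw [eval_equationWord]; simpa using h'⟩
  let P (v : Word ι) (o : PeriodData) : Prop :=
    (equationWord d d' v v (o.1, 0) o.2.1 ++ wh.power o.2.2).eval x = 1 ∧
      ∀ m ∈ List.range (M v.length + 1), m = 0 ∨ ¬(o.1 = 0 ∨ m < o.1) ∨ ¬R m v
  have hP : PrimrecRel P := by
    have h1 : Primrec fun z : Word ι × PeriodData => z.2.1 := Primrec.fst.comp Primrec.snd
    refine PrimrecPred.and (hwp.comp ?_) ?_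
    · exact Primrec.list_append.comp (primrec_equationWord d d' Primrec.fst Primrec.fst
        (Primrec.pair h1 (Primrec.const 0)) (Primrec.fst.comp (Primrec.snd.comp Primrec.snd)))
        ((Word.primrec_power wh).comp (Primrec.snd.comp (Primrec.snd.comp Primrec.snd)))
    · have h0 : PrimrecRel fun (m : ℕ) (z : Word ι × PeriodData) =>
          m = 0 ∨ ¬(z.2.1 = 0 ∨ m < z.2.1) ∨ ¬R m z.1 := by
        have hz : Primrec fun y : ℕ × (Word ι × PeriodData) => y.2.2.1 := h1.comp Primrec.snd
        refine PrimrecPred.or (Primrec.eq.comp Primrec.fst (Primrec.const 0)) (PrimrecPred.or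
          (PrimrecPred.not (PrimrecPred.or (Primrec.eq.comp hz (Primrec.const 0))
            (Primrec.nat_lt.comp Primrec.fst hz))) ?_)
        exact (hRprim.comp Primrec.fst (Primrec.fst.comp Primrec.snd)).not
      exact h0.forall_mem_list.comp (Primrec.list_range.comp (Primrec.succ.comp
        (hM.comp (Primrec.list_length.comp Primrec.fst)))) Primrec.id
  have hex (v : Word ι) : ∃ o, P v o := by
    classical
    by_cases h : ∃ m, 0 < m ∧ R m v
    · obtain ⟨h1, q, -, h2⟩ := Nat.find_spec h
      obtain ⟨j, hj⟩ := Subgroup.mem_zpowers_iff.1 (inv_mem h2)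
      obtain ⟨k, -, rfl⟩ := exists_mem_differences (le_refl j.natAbs)
      refine ⟨(Nat.find h, q, k), ?_, fun m _ => ?_⟩
      · rw [Word.eval_append, Word.eval_power, hj, mul_inv_cancel]
      · rcases Nat.eq_zero_or_pos m with hm | hm
        · exact Or.inl hm
        · by_cases hlt : m < Nat.find h
          · exact Or.inr (Or.inr fun hm' => Nat.find_min h hlt ⟨hm, hm'⟩)
          · right
            left
            simp only
            omega
    · refine ⟨(0, (0, 0), (0, 0)), ?_, fun m _ => ?_⟩
      · rw [Word.eval_append, eval_equationWord, Word.eval_power]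
        simp
      · rcases Nat.eq_zero_or_pos m with hm | hm
        · exact Or.inl hm
        · exact Or.inr (Or.inr fun hm' => h ⟨m, hm, hm'⟩)
  obtain ⟨f, hf, hfP⟩ := exists_computable_choice hP hex
  refine ⟨f, hf, fun v => ⟨?_, ?_⟩⟩
  · have h2 := (hfP v).1
    rw [equationWord, List.append_assoc, Word.eval_append, Word.eval_inv, inv_mul_eq_one] at h2
    conv_lhs => rw [h2]
    simp [mul_assoc, Word.eval_power]
  · have key (m : ℕ) (h0 : 0 < m) (hm : m ≤ M v.length) (h : (f v).1 = 0 ∨ m < (f v).1) :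
        ¬R m v := by
      rcases (hfP v).2 m (List.mem_range.2 (by omega)) with h' | h' | h'
      · omega
      · exact absurd h h'
      · exact h'
    rintro m h0 h ⟨n, hn⟩
    -- A period m beyond the tested range would yield one within it, which is smaller than m and so
    -- contradicts the tests as well.
    obtain ⟨m', n', h0', hm', hn'⟩ := hper v m n h0 hn
    rcases le_or_gt m (M v.length) with hm | hm
    · exact key m h0 hm h (hR' m v hm n hn)
    · exact key m' h0' hm' (by omega) (hR' m' v hm' n' hn')

/-- If the word problem and membership in `⟨h⟩` are primitive recursive, and the double coset
equation modulo `⟨h⟩` has small solutions and small periods, then the 2-cosets problem is solvable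
for `⟨d, h⟩` and `⟨d', h⟩`. -/
theorem solvable_of_bounds (x : ι → G) (d d' wh : Word ι)
    (hd : Commute (d.eval x) (wh.eval x)) (hd' : Commute (d'.eval x) (wh.eval x))
    (hn : ∀ g i, ∃ j : ℤ, wh.eval x ^ (i : ℤ) * g = g * wh.eval x ^ j)
    (hwp : PrimrecPred fun w : Word ι => w.eval x = 1)
    (hker : PrimrecPred fun w : Word ι => w.eval x ∈ Subgroup.zpowers (wh.eval x))
    {M N : ℕ → ℕ} (hM : Primrec M) (hN : Primrec N)
    (hsol : ∀ (u v : Word ι) (m n : ℤ), (u.eval x)⁻¹ * (d.eval x ^ m * v.eval x * d'.eval x ^ n) ∈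
      Subgroup.zpowers (wh.eval x) → ∃ m' n' : ℤ, m'.natAbs ≤ N (u.length + v.length) ∧
        n'.natAbs ≤ N (u.length + v.length) ∧ (u.eval x)⁻¹ *
          (d.eval x ^ m' * v.eval x * d'.eval x ^ n') ∈ Subgroup.zpowers (wh.eval x))
    (hper : ∀ (v : Word ι) (m : ℕ) (n : ℤ), 0 < m →
      (v.eval x)⁻¹ * (d.eval x ^ m * v.eval x * d'.eval x ^ n) ∈ Subgroup.zpowers (wh.eval x) →
      ∃ (m' : ℕ) (n' : ℤ), 0 < m' ∧ m' ≤ M (v.length + v.length) ∧ (v.eval x)⁻¹ *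
        (d.eval x ^ m' * v.eval x * d'.eval x ^ n') ∈ Subgroup.zpowers (wh.eval x))
    (hbd : ∀ (v : Word ι) (m : ℕ) (n : ℤ), m ≤ M (v.length + v.length) →
      (v.eval x)⁻¹ * (d.eval x ^ m * v.eval x * d'.eval x ^ n) ∈ Subgroup.zpowers (wh.eval x) →
      ∃ n' : ℤ, n'.natAbs ≤ N (v.length + v.length) ∧ (v.eval x)⁻¹ *
        (d.eval x ^ m * v.eval x * d'.eval x ^ n') ∈ Subgroup.zpowers (wh.eval x)) :
    Solvable x (Subgroup.closure {d.eval x, wh.eval x})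
      (Subgroup.closure {d'.eval x, wh.eval x}) := by
  have hdouble : Primrec fun k : ℕ => k + k := Primrec.nat_add.comp Primrec.id Primrec.id
  obtain ⟨f, hf, hfs⟩ := exists_computable_solution x d d' wh hwp hker hN hsol
  obtain ⟨g, hg, hgs⟩ := exists_computable_period x d d' wh hwp hker (hM.comp hdouble)
    (hN.comp hdouble) hper hbd
  -- The subgroup generators are (h, v⁻¹h⁻¹v) and (d^r, s); the base point of the coset comes from
  -- the first search, r and s from the second.
  let F (y : Word ι × Word ι) : Description ι :=
    bif (f y).1 then
      some ((d.power (f y).2.1, d'.power (f y).2.2.1 ++ wh.power (f y).2.2.2),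
        [(wh, y.2.inv ++ (wh.inv ++ y.2)),
          (d.power ((g y.2).1, 0), d'.power (g y.2).2.1 ++ wh.power (g y.2).2.2)])
    else none
  refine ⟨F, ?_, fun u v => ?_⟩
  · have hgy : Computable fun y : Word ι × Word ι => g y.2 := hg.comp Computable.snd
    have app {a b : Word ι × Word ι → Word ι} (ha : Computable a) (hb : Computable b) :
        Computable fun y => a y ++ b y := Primrec.list_append.to_comp.comp ha hb
    have pow (w : Word ι) {a : Word ι × Word ι → ℕ × ℕ} (ha : Computable a) :
        Computable fun y => w.power (a y) := (Word.primrec_power w).to_comp.comp ha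
    refine Computable.cond (Computable.fst.comp hf) (Computable.option_some.comp
      (Computable.pair (Computable.pair ?_ ?_) ?_)) (Computable.const none)
    · exact pow d (Computable.fst.comp (Computable.snd.comp hf))
    · exact app (pow d' (Computable.fst.comp (Computable.snd.comp (Computable.snd.comp hf))))
        (pow wh (Computable.snd.comp (Computable.snd.comp (Computable.snd.comp hf))))
    · refine Computable.list_cons.comp (Computable.pair (Computable.const wh) ?_)
        (Computable.list_cons.comp (Computable.pair ?_ ?_) (Computable.const []))
      · exact app (Word.primrec_inv.to_comp.comp Computable.snd)
          (app (Computable.const wh.inv) Computable.snd)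
      · exact pow d (Computable.pair (Computable.fst.comp hgy) (Computable.const 0))
      · exact app (pow d' (Computable.fst.comp (Computable.snd.comp hgy)))
          (pow wh (Computable.snd.comp (Computable.snd.comp hgy)))
  · have hmemd (w : Word ι) (p : ℕ × ℕ) :
        (w.power p).eval x ∈ Subgroup.closure {w.eval x, wh.eval x} := by
      rw [Word.eval_power]
      exact zpow_mem (Subgroup.subset_closure (by simp)) _
    have hmemh (w : Word ι) (p : ℕ × ℕ) :
        (wh.power p).eval x ∈ Subgroup.closure {w.eval x, wh.eval x} := by
      rw [Word.eval_power]
      exact zpow_mem (Subgroup.subset_closure (by simp)) _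
    rcases hfs u v with ⟨h1, h2⟩ | ⟨h1, h2⟩
    · have hF : F (u, v) = none := by simp [F, h1]
      rw [hF, exists_mem_zpowers_iff_solutions_nonempty hd hd' hn,
        Set.not_nonempty_iff_eq_empty] at *
      exact h2
    · have hF : F (u, v) = some ((d.power (f (u, v)).2.1,
          d'.power (f (u, v)).2.2.1 ++ wh.power (f (u, v)).2.2.2), [(wh, v.inv ++ (wh.inv ++ v)),
          (d.power ((g v).1, 0), d'.power (g v).2.1 ++ wh.power (g v).2.2)]) := by
        simp only [F, h1, cond_true]
      obtain ⟨h3, h4⟩ := hgs v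
      rw [hF, solutions_eq_coset hd hd' hn (hmemd d _)
        (by rw [Word.eval_append]; exact mul_mem (hmemd d' _) (hmemh d' _)) h2
        (by rw [Word.eval_append]; exact mul_mem (hmemd d' _) (hmemh d' _)) h3
        (fun m h0 hm hmem => h4 m h0 hm ((exists_mem_zpowers_iff_mem_closure hd' _ _).2 hmem))]
      have hset : {y : G × G | ∃ l ∈ [(wh, v.inv ++ (wh.inv ++ v)),
          (d.power ((g v).1, 0), d'.power (g v).2.1 ++ wh.power (g v).2.2)], y = evalPair x l} =
          {(wh.eval x, (v.eval x)⁻¹ * (wh.eval x)⁻¹ * v.eval x),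
            (d.eval x ^ (g v).1, (d'.power (g v).2.1 ++ wh.power (g v).2.2).eval x)} := by
        ext y
        simp [evalPair, Word.eval_power, mul_assoc]
      rw [Description.toSet, hset]
      rfl

end TwoCosets

/-! ### Seifert groups -/

/-- Isolates the last boundary generator in the long relation, so that it can be solved for. -/
theorem List.prod_ofFn_eq_mul_last {G : Type} [Group G] {p : ℕ} (x y : Fin p → G) (k : Fin p)
    (hk : (k : ℕ) + 1 = p) (hne : ∀ i, i ≠ k → x i = y i) (hy : y k = 1) :
    (List.ofFn x).prod = (List.ofFn y).prod * x k := by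
  obtain ⟨p, rfl⟩ : ∃ p', p = p' + 1 := ⟨k, hk.symm⟩
  obtain rfl : k = Fin.last p := Fin.ext (by simpa using hk)
  have e : (fun i : Fin p => x i.castSucc) = fun i => y i.castSucc :=
    funext fun i => hne _ (Fin.castSucc_ne_last i)
  rw [List.ofFn_succ_last, List.ofFn_succ_last, e]
  simp [hy]

namespace CyclicFreeProduct

/-- The universal property of a free product of cyclic groups. -/
theorem exists_hom {J : Type} (n : J → ℕ) {Q : Type} [Group Q] (q : J → Q)
    (hq : ∀ i, q i ^ n i = 1) : ∃ f : FreeProd n →* Q, ∀ i, f (factorGen n i) = q i := by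
  refine ⟨Monoid.CoprodI.lift fun i => AddMonoidHom.toMultiplicativeLeft
    (ZMod.lift (n i) ⟨zmultiplesHom (Additive Q) (Additive.ofMul (q i)), ?_⟩), fun i => ?_⟩
  · rw [zmultiplesHom_apply, natCast_zsmul, ← ofMul_pow, hq, ofMul_one]
  · rw [factorGen, Monoid.CoprodI.lift_of]
    have := ZMod.lift_coe (n i) ⟨zmultiplesHom (Additive Q) (Additive.ofMul (q i)), by
      rw [zmultiplesHom_apply, natCast_zsmul, ← ofMul_pow, hq, ofMul_one]⟩ 1
    simp only [Int.cast_one] at this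
    simp [this]

end CyclicFreeProduct

instance (B : SeifertBase) : Finite B.Gen :=
  match B with
  | .orientable g => inferInstanceAs (Finite (Fin g ⊕ Fin g))
  | .nonorientable g _ => inferInstanceAs (Finite (Fin g))

namespace SeifertInvariants

open CyclicFreeProduct TwoCosets

/-! ### The canonical presentation and normality of the fibre subgroup -/

theorem map_baseProd {F F' : Type} [Group F] [Group F'] (f : F →* F') :
    ∀ (B : SeifertBase) (x : B.Gen → F), f (baseProd B x) = baseProd B fun s => f (x s)
  | .orientable g, x => by simp [baseProd, map_list_prod, List.map_ofFn, Function.comp_def]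
  | .nonorientable g _, x => by simp [baseProd, map_list_prod, List.map_ofFn, Function.comp_def]

theorem map_baseRelator {F F' : Type} [Group F] [Group F'] (f : F →* F') :
    ∀ (B : SeifertBase) (s h : F), f (baseRelator B s h) = baseRelator B (f s) (f h)
  | .orientable _, s, h => by simp [baseRelator]
  | .nonorientable _ _, s, h => by simp [baseRelator]

theorem baseRelator_one {F : Type} [Group F] : ∀ (B : SeifertBase) (s : F), baseRelator B s 1 = 1
  | .orientable _, s => by simp [baseRelator]
  | .nonorientable _ _, s => by simp [baseRelator]

variable (I : SeifertInvariants)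

/-- The generator `h`. -/
def h : I.Pi1 := I.gen (.inr (.inr (.inr ())))

/-- The generator `d_k`. -/
def d (k : Fin I.p) : I.Pi1 := I.gen (.inr (.inr (.inl k)))

/-- The generator `c_j`. -/
def c (j : Fin I.q) : I.Pi1 := I.gen (.inr (.inl j))

/-- A family of elements of a group that satisfies the relations of the canonical presentation
defines a homomorphism. -/
theorem exists_hom_of_relations {Q : Type} [Group Q] (x : I.Gen → Q)
    (hbase : ∀ s, baseRelator I.base (x (.inl s)) (x (.inr (.inr (.inr ())))) = 1)
    (hc : ∀ j, Commute (x (.inr (.inl j))) (x (.inr (.inr (.inr ())))))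
    (hd : ∀ k, Commute (x (.inr (.inr (.inl k)))) (x (.inr (.inr (.inr ())))))
    (hpow : ∀ j, x (.inr (.inl j)) ^ I.α j = x (.inr (.inr (.inr ()))) ^ I.β j)
    (hlong : baseProd I.base (fun s => x (.inl s)) * (List.ofFn fun j => x (.inr (.inl j))).prod *
      (List.ofFn fun k => x (.inr (.inr (.inl k)))).prod = x (.inr (.inr (.inr ()))) ^ I.b) :
    ∃ f : I.Pi1 →* Q, ∀ i, f (I.gen i) = x i := by
  have hcomm {a b : Q} (h : Commute a b) : a * b * a⁻¹ * b⁻¹ = 1 := by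
    rw [h.eq]
    group
  refine ⟨PresentedGroup.toGroup (f := x) ?_, fun i => PresentedGroup.toGroup.of _⟩
  rintro r (hr : Relator I r)
  cases hr with
  | base s => simpa [map_baseRelator, fBase, fh] using hbase s
  | c_comm j => simpa [fc, fh] using hcomm (hc j)
  | d_comm k => simpa [fd, fh] using hcomm (hd k)
  | c_pow j => simp [fc, fh, hpow]
  | long =>
    simp only [map_mul, map_inv, map_zpow, map_baseProd, map_list_prod, List.map_ofFn,
      Function.comp_def, fBase, fc, fd, fh, FreeGroup.lift_apply_of]
    rw [hlong, mul_inv_cancel]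

theorem relations :
    (∀ s, baseRelator I.base (I.gen (.inl s)) I.h = 1) ∧ (∀ j, Commute (I.c j) I.h) ∧
      (∀ k, Commute (I.d k) I.h) ∧ (∀ j, I.c j ^ I.α j = I.h ^ I.β j) ∧
      baseProd I.base (fun s => I.gen (.inl s)) * (List.ofFn I.c).prod * (List.ofFn I.d).prod =
        I.h ^ I.b := by
  let q : FreeGroup I.Gen →* I.Pi1 := PresentedGroup.mk _
  have hq {r : FreeGroup I.Gen} (hr : Relator I r) : q r = 1 := PresentedGroup.one_of_mem hr
  have hof (i : I.Gen) : q (FreeGroup.of i) = I.gen i := rfl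
  have hcomm {a b : I.Pi1} (h : a * b * a⁻¹ * b⁻¹ = 1) : Commute a b :=
    mul_inv_eq_iff_eq_mul.1 (mul_inv_eq_one.1 h)
  refine ⟨fun s => ?_, fun j => hcomm ?_, fun k => hcomm ?_, fun j => ?_, ?_⟩
  · have := hq (.base s)
    simp only [map_baseRelator, fBase, fh, hof] at this
    exact this
  · have := hq (.c_comm j)
    simp only [fc, fh, hof, map_mul, map_inv] at this
    exact this
  · have := hq (.d_comm k)
    simp only [fd, fh, hof, map_mul, map_inv] at this
    exact this
  · have := hq (.c_pow j)
    simp only [fc, fh, hof, map_mul, map_inv, map_pow, mul_inv_eq_one] at this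
    exact this
  · have := hq .long
    simp only [map_mul, map_inv, map_zpow, map_baseProd, map_list_prod, List.map_ofFn,
      Function.comp_def, fBase, fc, fd, fh, hof, mul_inv_eq_one] at this
    exact this

theorem closure_range_gen : Subgroup.closure (Set.range I.gen) = ⊤ :=
  PresentedGroup.closure_range_of _

theorem conj_h (g : I.Pi1) : g * I.h * g⁻¹ = I.h ∨ g * I.h * g⁻¹ = I.h⁻¹ := by
  obtain ⟨hs, hc, hd, -, -⟩ := I.relations
  have hg : g ∈ Subgroup.closure (Set.range I.gen) := I.closure_range_gen ▸ Subgroup.mem_top g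
  induction hg using Subgroup.closure_induction with
  | mem g hg =>
    obtain ⟨s | j | k | u, rfl⟩ := hg
    · have h := hs s
      generalize I.gen (.inl s) = g at h
      revert h
      cases I.base with
      | orientable _ => exact fun h => Or.inl (mul_inv_eq_one.1 h)
      | nonorientable _ _ => exact fun h => Or.inr (eq_inv_of_mul_eq_one_left h)
    · exact Or.inl (mul_inv_eq_iff_eq_mul.2 (hc j).eq)
    · exact Or.inl (mul_inv_eq_iff_eq_mul.2 (hd k).eq)
    · exact Or.inl (mul_inv_cancel_right _ _)
  | one => simp
  | mul a b _ _ ha hb =>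
    have e : a * b * I.h * (a * b)⁻¹ = a * (b * I.h * b⁻¹) * a⁻¹ := by group
    rw [e]
    rcases hb with hb | hb <;> rw [hb]
    · exact ha
    · have e : a * I.h⁻¹ * a⁻¹ = (a * I.h * a⁻¹)⁻¹ := by group
      rw [e]
      rcases ha with ha | ha <;> simp [ha]
  | inv a _ ha =>
    have e (y : I.Pi1) (h : a * I.h * a⁻¹ = y) : a⁻¹ * y * a⁻¹⁻¹ = I.h := by rw [← h]; group
    rcases ha with ha | ha
    · exact Or.inl (e _ ha)
    · right
      calc a⁻¹ * I.h * a⁻¹⁻¹ = (a⁻¹ * I.h⁻¹ * a⁻¹⁻¹)⁻¹ := by group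
        _ = I.h⁻¹ := by rw [e _ ha]

theorem exists_zpow_h_mul (g : I.Pi1) (i : ℤ) : ∃ j : ℤ, I.h ^ i * g = g * I.h ^ j := by
  have e : I.h ^ i * g = g * (g⁻¹ * I.h * g⁻¹⁻¹) ^ i := by
    rw [conj_zpow]
    group
  rw [e]
  rcases I.conj_h g⁻¹ with h | h
  · exact ⟨i, by rw [h]⟩
  · exact ⟨-i, by rw [h, inv_zpow, zpow_neg]⟩

/-! ### The quotient by the fibre -/

/-- The orders of the cyclic factors of the quotient of the fundamental group by `⟨h⟩`, where the
last boundary generator is eliminated. -/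
def order : I.Gen → ℕ
  | .inl _ => 0
  | .inr (.inl j) => I.α j
  -- Order 1 gives a trivial factor, which lets the canonical generators keep indexing the factors
  -- although the last d_k and h are dropped.
  | .inr (.inr (.inl k)) => if (k : ℕ) + 1 = I.p then 1 else 0
  | .inr (.inr (.inr _)) => 1

/-- The images of the canonical generators in the free product of cyclic groups. -/
def quotientGen : I.Gen → FreeProd I.order
  | .inl s => factorGen I.order (.inl s)
  | .inr (.inl j) => factorGen I.order (.inr (.inl j))
  | .inr (.inr (.inl k)) =>
    if (k : ℕ) + 1 = I.p then
      -- The value of the last d_k forced by the long relation with h = 1. The product over all k is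
      -- in fact over the others, as the last factor is trivial.
      (baseProd I.base (fun s => factorGen I.order (.inl s)) *
        (List.ofFn fun j => factorGen I.order (.inr (.inl j))).prod *
        (List.ofFn fun k => factorGen I.order (.inr (.inr (.inl k)))).prod)⁻¹
    else factorGen I.order (.inr (.inr (.inl k)))
  | .inr (.inr (.inr _)) => 1

/-- The fundamental group maps to a free product of cyclic groups with kernel `⟨h⟩`. -/
theorem exists_quotient (hp : 1 ≤ I.p) : ∃ f : I.Pi1 →* FreeProd I.order,
    ∀ g, f g = 1 ↔ g ∈ Subgroup.zpowers I.h := by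
  obtain ⟨-, -, -, hpow', hlong'⟩ := I.relations
  let last : Fin I.p := ⟨I.p - 1, by omega⟩
  have hlast : (last : ℕ) + 1 = I.p := Nat.sub_add_cancel hp
  have hne (k : Fin I.p) (hk : k ≠ last) : ¬((k : ℕ) + 1 = I.p) := fun h =>
    hk (Fin.ext (by omega))
  obtain ⟨f, hf⟩ := I.exists_hom_of_relations I.quotientGen (fun s => baseRelator_one _ _)
    (fun j => Commute.one_right _) (fun k => Commute.one_right _)
    (fun j => by
      have := factorGen_pow I.order (.inr (.inl j))
      simpa [quotientGen, order] using this)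
    (by
      rw [List.prod_ofFn_eq_mul_last (fun k => I.quotientGen (.inr (.inr (.inl k))))
        (fun k => factorGen I.order (.inr (.inr (.inl k)))) last hlast]
      · simp only [quotientGen, hlast, if_true, one_zpow]
        group
      · intro k hk
        simp [quotientGen, hne k hk]
      · have := factorGen_pow I.order (.inr (.inr (.inl last)))
        simpa [order, hlast] using this)
  refine ⟨f, fun g => ⟨fun hg => ?_, ?_⟩⟩
  · have hnormal : (Subgroup.zpowers I.h).Normal := by
      refine ⟨fun y hy g => ?_⟩
      obtain ⟨i, rfl⟩ := Subgroup.mem_zpowers_iff.1 hy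
      rw [← conj_zpow]
      refine zpow_mem ?_ i
      rcases I.conj_h g with h | h <;> rw [h] <;> simp
    let q : I.Pi1 →* I.Pi1 ⧸ Subgroup.zpowers I.h := QuotientGroup.mk' _
    have hqh : q I.h = 1 := (QuotientGroup.eq_one_iff _).2 (Subgroup.mem_zpowers _)
    -- These images define a map r from the free product back to G/⟨h⟩ whose composite with f is the
    -- projection q; hence the kernel of f is contained in ⟨h⟩.
    let y : I.Gen → I.Pi1 ⧸ Subgroup.zpowers I.h := fun i =>
      match i with
      | .inl s => q (I.gen (.inl s))
      | .inr (.inl j) => q (I.c j)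
      | .inr (.inr (.inl k)) => if (k : ℕ) + 1 = I.p then 1 else q (I.d k)
      | .inr (.inr (.inr _)) => 1
    obtain ⟨r, hr⟩ := CyclicFreeProduct.exists_hom I.order y (by
      rintro (s | j | k | u)
      · exact pow_zero _
      · change q (I.c j) ^ I.α j = 1
        rw [← map_pow, hpow', map_pow, hqh, one_pow]
      · by_cases hk : (k : ℕ) + 1 = I.p <;> simp [order, hk, y]
      · exact one_pow _)
    have hcomp : r.comp f = q := by
      refine PresentedGroup.ext fun i => ?_
      change r (f (I.gen i)) = q (I.gen i)
      rw [hf]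
      rcases i with s | j | k | u
      · exact hr _
      · exact hr _
      · by_cases hk : (k : ℕ) + 1 = I.p
        · obtain rfl : k = last := Fin.ext (by omega)
          have e : q (baseProd I.base (fun s => I.gen (.inl s)) * (List.ofFn I.c).prod *
              (List.ofFn I.d).prod) = 1 := by rw [hlong', map_zpow, hqh, one_zpow]
          simp only [map_mul, map_baseProd, map_list_prod, List.map_ofFn, Function.comp_def] at e
          rw [List.prod_ofFn_eq_mul_last (fun k => q (I.d k))
            (fun k => y (.inr (.inr (.inl k)))) last hlast
            (fun k hk => by simp [y, hne k hk]) (by simp [y, hlast])] at e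
          simp only [quotientGen, hk, if_true, map_inv, map_mul, map_baseProd, map_list_prod,
            List.map_ofFn, Function.comp_def, hr]
          rw [inv_eq_iff_mul_eq_one]
          rw [← mul_assoc] at e
          exact e
        · simp only [quotientGen, hk, if_false, hr, y]
          rfl
      · exact (map_one r).trans hqh.symm
    have := DFunLike.congr_fun hcomp g
    rw [MonoidHom.comp_apply, hg, map_one] at this
    exact (QuotientGroup.eq_one_iff g).1 this.symm
  · intro hg
    obtain ⟨i, rfl⟩ := Subgroup.mem_zpowers_iff.1 hg
    rw [map_zpow, h, hf]
    exact one_zpow i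

/-! ### Detecting the powers of the fibre -/

/-- Translations of the integers. -/
def translation : Multiplicative ℤ →* Equiv.Perm ℤ where
  toFun t := Equiv.addRight t.toAdd
  map_one' := by ext; simp
  map_mul' s t := by ext; simp; ring

/-- A common image for all generators of the base: the identity if the base is orientable, the
reflection z ↦ -z otherwise, which inverts translations and has square 1. -/
theorem baseProd_translation_part : ∀ B : SeifertBase,
    ∃ x : Equiv.Perm ℤ, ((∀ z, x z = z) ∨ ∀ z, x z = -z) ∧ (baseProd B fun _ => x) = 1 ∧
      ∀ t, baseRelator B x (translation t) = 1
  | .orientable g => ⟨1, Or.inl fun _ => rfl, by simp [baseProd], fun t => by simp [baseRelator]⟩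
  | .nonorientable g _ => by
    refine ⟨Equiv.neg ℤ, Or.inr fun _ => rfl, ?_, fun t => ?_⟩
    · have : (Equiv.neg ℤ : Equiv.Perm ℤ) ^ 2 = 1 := by ext; simp [pow_two]
      simp [baseProd, this]
    · have : (Equiv.neg ℤ : Equiv.Perm ℤ)⁻¹ = Equiv.neg ℤ := by ext; simp [Equiv.Perm.inv_def]
      ext
      simp [baseRelator, this, translation]

/-- There is an action on the integers, by translations and reflections, for which the powers of
`h` move `0`. -/
theorem exists_action (hp : 1 ≤ I.p) : ∃ f : I.Pi1 →* Equiv.Perm ℤ,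
    (∀ i, (∃ t, ∀ z, f (I.gen i) z = z + t) ∨ ∀ z, f (I.gen i) z = -z) ∧
      ∀ e : ℤ, f (I.h ^ e) 0 = 0 → e = 0 := by
  let last : Fin I.p := ⟨I.p - 1, by omega⟩
  have hlast : (last : ℕ) + 1 = I.p := Nat.sub_add_cancel hp
  have hne (k : Fin I.p) (hk : k ≠ last) : ¬((k : ℕ) + 1 = I.p) := fun h =>
    hk (Fin.ext (by omega))
  obtain ⟨s, hs, hsprod, hsrel⟩ := baseProd_translation_part I.base
  -- The generator h acts as translation by A, a nonzero multiple of every α_j, so that c_j can act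
  -- as translation by A β_j / α_j. The last d_k absorbs the long relation; the other d_k act
  -- trivially.
  let A : ℕ := ∏ j, I.α j
  let T : Multiplicative ℤ := Multiplicative.ofAdd (A : ℤ)
  let t (j : Fin I.q) : Multiplicative ℤ := Multiplicative.ofAdd ((A / I.α j * I.β j : ℕ) : ℤ)
  have hA : 0 < A := Finset.prod_pos fun j _ => (I.β_pos j).trans (I.β_lt_α j)
  have ht (j : Fin I.q) : t j ^ I.α j = T ^ I.β j := by
    have h1 : I.α j * (A / I.α j) = A :=
      Nat.mul_div_cancel' (Finset.dvd_prod_of_mem _ (Finset.mem_univ j))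
    simp only [t, T]
    rw [← ofAdd_nsmul, ← ofAdd_nsmul]
    congr 1
    conv_rhs => rw [← h1]
    push_cast [nsmul_eq_mul]
    ring
  let x : I.Gen → Equiv.Perm ℤ := fun i =>
    match i with
    | .inl _ => s
    | .inr (.inl j) => translation (t j)
    | .inr (.inr (.inl k)) => translation
      (if (k : ℕ) + 1 = I.p then (List.ofFn t).prod⁻¹ * T ^ I.b else 1)
    | .inr (.inr (.inr _)) => translation T
  have hcomm (a b : Multiplicative ℤ) : Commute (translation a) (translation b) :=
    (Commute.all a b).map translation
  obtain ⟨f, hf⟩ := I.exists_hom_of_relations x (fun _ => hsrel _) (fun j => hcomm _ _)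
    (fun k => hcomm _ _) (fun j => by simp only [x, ← map_pow, ht])
    (by
      rw [List.prod_ofFn_eq_mul_last (fun k => x (.inr (.inr (.inl k)))) (fun _ => 1) last hlast
        (fun k hk => by simp [x, hne k hk]) rfl]
      have e : (List.ofFn fun j => x (.inr (.inl j))).prod = translation (List.ofFn t).prod := by
        simp [x, map_list_prod, List.map_ofFn, Function.comp_def]
      rw [e]
      simp [x, hsprod, hlast])
  refine ⟨f, fun i => ?_, fun e he => ?_⟩
  · rw [hf]
    rcases i with b | j | k | u
    · rcases hs with hs | hs
      · exact Or.inl ⟨0, fun z => by simp [x, hs]⟩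
      · exact Or.inr hs
    · exact Or.inl ⟨_, fun z => rfl⟩
    · exact Or.inl ⟨_, fun z => rfl⟩
    · exact Or.inl ⟨_, fun z => rfl⟩
  · rw [map_zpow, h, hf] at he
    simp only [x, ← map_zpow] at he
    simp only [translation, MonoidHom.coe_mk, OneHom.coe_mk, Equiv.coe_addRight, zero_add, T,
      toAdd_zpow, toAdd_ofAdd, smul_eq_mul, mul_eq_zero] at he
    omega

/-! ### Solvability -/

/-- Conjugation takes h to h or h⁻¹, so every boundary subgroup contains the same fibre subgroup
⟨h⟩. -/
theorem map_conj_torusSubgroup (k : Fin I.p) (x : I.Pi1) :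
    (I.torusSubgroup k).map (MulAut.conj x).toMonoidHom =
      Subgroup.closure {x * I.d k * x⁻¹, I.h} := by
  have e : (I.torusSubgroup k).map (MulAut.conj x).toMonoidHom =
      Subgroup.closure {x * I.d k * x⁻¹, x * I.h * x⁻¹} := by
    rw [torusSubgroup, MonoidHom.map_closure, Set.image_pair]
    rfl
  rw [e]
  rcases I.conj_h x with h | h
  · rw [h]
  · rw [h]
    refine le_antisymm ?_ ?_ <;> rw [Subgroup.closure_le] <;> rintro y (rfl | rfl)
    · exact Subgroup.subset_closure (by simp)
    · exact inv_mem (Subgroup.subset_closure (by simp))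
    · exact Subgroup.subset_closure (by simp)
    · rw [← inv_inv I.h]
      exact inv_mem (Subgroup.subset_closure (by simp))

theorem commute_conj_d_h (k : Fin I.p) (x : I.Pi1) : Commute (x * I.d k * x⁻¹) I.h := by
  have hc : Commute (x * I.d k * x⁻¹) (x * I.h * x⁻¹) :=
    (I.relations.2.2.1 k).map (MulAut.conj x).toMonoidHom
  rcases I.conj_h x with h | h
  · rwa [h] at hc
  · rw [h] at hc
    simpa using hc.inv_right

theorem solvable_closure_pair (hp : 1 ≤ I.p) {d₁ d₂ : I.Pi1} (h₁ : Commute d₁ I.h)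
    (h₂ : Commute d₂ I.h) :
    Solvable I.gen (Subgroup.closure {d₁, I.h}) (Subgroup.closure {d₂, I.h}) := by
  classical
  obtain ⟨f, hf⟩ := I.exists_quotient hp
  obtain ⟨act, hact, hact0⟩ := I.exists_action hp
  let wh : Word I.Gen := [(.inr (.inr (.inr ())), true)]
  have hwh : wh.eval I.gen = I.h := by simp [wh, Word.letter, h]
  obtain ⟨w₁, rfl⟩ := Word.exists_eval_eq I.gen I.closure_range_gen d₁
  obtain ⟨w₂, rfl⟩ := Word.exists_eval_eq I.gen I.closure_range_gen d₂
  have hker : PrimrecPred fun w : Word I.Gen => w.eval I.gen ∈ Subgroup.zpowers I.h :=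
    (primrecPred_eval_eq_one I.order fun i => f (I.gen i)).of_eq fun w => by
      rw [← Word.map_eval, hf]
  have hzero : PrimrecPred fun w : Word I.Gen => act (w.eval I.gen) 0 = 0 :=
    (Word.primrecPred_eval_zero (fun i => act (I.gen i)) hact).of_eq fun w => by
      rw [← Word.map_eval]
  -- A word is trivial exactly when it represents a power of h and fixes 0 in the action on ℤ.
  have hwp : PrimrecPred fun w : Word I.Gen => w.eval I.gen = 1 :=
    (hker.and hzero).of_eq fun w => by
      constructor
      · rintro ⟨hw, h0⟩
        obtain ⟨e, he⟩ := Subgroup.mem_zpowers_iff.1 hw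
        rw [← he] at h0 ⊢
        rw [hact0 e h0, zpow_zero]
      · intro hw
        rw [hw]
        exact ⟨one_mem _, by simp⟩
  have hℓ := FreeProductLength.isTreeLength_length (fun i : I.Gen =>
    isTreeLength_cyclicWeight (I.order i))
  obtain ⟨E, hE0, hE⟩ := FreeProductLength.ballBound_length (fun i : I.Gen =>
    exists_mem_pow_cyclicWeight (I.order i))
  obtain ⟨K, hK⟩ := hℓ.exists_small_solution hE0 hE (f (w₁.eval I.gen)) (f (w₂.eval I.gen))
  obtain ⟨C, hC⟩ := Word.length_eval_le hℓ fun i => f (I.gen i)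
  simp only [← Word.map_eval] at hC
  have hiff (u v : Word I.Gen) (m n : ℤ) : (u.eval I.gen)⁻¹ *
      (w₁.eval I.gen ^ m * v.eval I.gen * w₂.eval I.gen ^ n) ∈ Subgroup.zpowers I.h ↔
      f (w₁.eval I.gen) ^ m * f (v.eval I.gen) * f (w₂.eval I.gen) ^ n = f (u.eval I.gen) := by
    rw [← hf, map_mul, map_inv, inv_mul_eq_one, eq_comm]
    simp
  -- Passes from tree lengths to word lengths: the bounds of `exists_small_solution` are used with t
  -- equal to C times the total length of the words.
  have hadd (u v : Word I.Gen) := (Nat.add_le_add (hC u) (hC v)).trans_eq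
    (mul_add C u.length v.length).symm
  have hpow : Primrec₂ fun a b : ℕ => a ^ b := Primrec₂.unpaired'.1 Nat.Primrec.pow
  have hlin : Primrec fun t : ℕ => K + C * t :=
    Primrec.nat_add.comp (Primrec.const K) (Primrec.nat_mul.comp (Primrec.const C) Primrec.id)
  have hM : Primrec fun t : ℕ => E ^ (K + C * t) := hpow.comp (Primrec.const E) hlin
  have hN : Primrec fun t : ℕ => E ^ (K + C * t + E ^ (K + C * t) * K) :=
    hpow.comp (Primrec.const E)
      (Primrec.nat_add.comp hlin (Primrec.nat_mul.comp hM (Primrec.const K)))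
  rw [← hwh] at h₁ h₂ hker hiff ⊢
  refine solvable_of_bounds I.gen w₁ w₂ wh h₁ h₂ (by rw [hwh]; exact I.exists_zpow_h_mul)
    hwp hker hM hN ?_ ?_ ?_
  · intro u v m n h
    rw [hiff] at h
    obtain ⟨m', n', hm, hn, h'⟩ := (hK _).1 _ _ m n (hadd u v) h
    refine ⟨m', n', hm.trans (Nat.pow_le_pow_right hE0 (Nat.le_add_right _ _)), hn, ?_⟩
    rwa [hiff]
  · intro v m n h0 h
    rw [← zpow_natCast, hiff, zpow_natCast] at h
    obtain ⟨m', n', h0', hm, h'⟩ := (hK _).2.1 _ m n (hadd v v) h0 h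
    refine ⟨m', n', h0', hm, ?_⟩
    rwa [← zpow_natCast, hiff, zpow_natCast]
  · intro v m n hm h
    rw [← zpow_natCast, hiff] at h
    obtain ⟨n', hn, h'⟩ := (hK _).2.2 _ _ m n (hadd v v) (by simpa using hm) h
    refine ⟨n', hn, ?_⟩
    rwa [← zpow_natCast, hiff]

end SeifertInvariants

theorem proposition5p2 (I : SeifertInvariants) (hp : 1 ≤ I.p) (T T' : Subgroup I.Pi1)
    (hT : I.IsBoundarySubgroup T) (hT' : I.IsBoundarySubgroup T') :
    TwoCosets.Solvable I.gen T T' := by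
  obtain ⟨k, x, rfl⟩ := hT
  obtain ⟨k', x', rfl⟩ := hT'
  rw [I.map_conj_torusSubgroup, I.map_conj_torusSubgroup]
  exact I.solvable_closure_pair hp (I.commute_conj_d_h k x) (I.commute_conj_d_h k' x')
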